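/- **Setting.** Let $\mathcal B$ be a $C^*$-algebra, $E$ a $C^*$-correspondence over $\mathcal B$ (a right Hilbert $C^*$-module over $\mathcal B$ with a nondegenerate left action $\phi:\mathcal B\to\mathcal L(E)$), and $(\sigma,V)$ a completely bounded covariant (c.b.c.) representation of $E$ on a Hilbert space $\mathcal H$: $\sigma:\mathcal B\to B(\mathcal H)$ is a nondegenerate $*$-representation and $V:E\to B(\mathcal H)$ is a completely bounded linear map with $V(b\xi c)=\sigma(b)V(\xi)\sigma(c)$. Let $\widetilde V:E\otimes_\sigma\mathcal H\to\mathcal H$ be the bounded operator $\widetilde V(\xi\otimes h)=V(\xi)h$. For a subspace $\mathcal M\subseteq\mathcal H$, $E\otimes\mathcal M$ denotes the closed linear span in $E\otimes_\sigma\mathcal H$ of the $\xi\otimes m$ ($\xi\in E$, $m\in\mathcal M$), and similarly for $E^{\otimes n}\otimes\mathcal M$. $R(\cdot)$ and $N(\cdot)$ denote range and kernel, and $\oplus$ denotes an orthogonal sum. For $T:E\otimes\mathcal H\to\mathcal H$ commuting with the actions of $\mathcal B$ put $T_0=I_{\mathcal H}$ and $T_n=T(I_E\otimes T)\cdots(I_{E^{\otimes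 n-1}}\otimes T):E^{\otimes n}\otimes\mathcal H\to\mathcal H$, and $R^\infty(T)=\bigcap_{n\ge0}R(T_n)$. $(\sigma,V)$ is *regular* if $R(\widetilde V)$ is closed and $N(\widetilde V)\subseteq E\otimes R^\infty(\widetilde V)$. In this case let $\widetilde V^\dagger:\mathcal H\to E\otimes\mathcal H$ be the Moore–Penrose inverse of $\widetilde V$, $\widetilde V^{\dagger(n)}=(I_{E^{\otimes n-1}}\otimes\widetilde V^\dagger)\cdots(I_E\otimes\widetilde V^\dagger)\widetilde V^\dagger$, and $\widetilde V'=\widetilde V(\widetilde V^*\widetilde V)^\dagger$ the Cauchy dual. $(\sigma,V)$ is *bi-regular* if it is regular and $N(I_{E^{\otimes n}}\otimes\widetilde V^\dagger)\subseteq R(\widetilde V^{\dagger(n)})$ for all $n$. Let $\mathcal E=\mathcal H\ominus R(\widetilde V)$ and $[\mathcal E]_{\widetilde V}=\bigvee_{n\ge0}\widetilde V_n(E^{\otimes n}\otimes\mathcal E)$ (closed linear span). **Theorem.** Let $(\sigma,V)$ be a bi-regular c.b.c. representation of $E$ on $\mathcal H$. The following are equivalent: 1. $\mathcal H\neq[\mathcal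 E]_{\widetilde V}$; 2. $R^\infty(\widetilde V')\neq\{0\}$; 3. there is a non-zero closed subspace $\mathcal M\subseteq\mathcal H$ with $\mathcal M\subseteq\widetilde V'(E\otimes\mathcal M)$; 4. there is a non-zero closed subspace $\mathcal M\subseteq R(\widetilde V)$ with $\widetilde V^*\mathcal M\subseteq E\otimes\mathcal M$; 5. there is a closed subspace $\mathcal M\supseteq\mathcal E$, $\mathcal M\neq\mathcal H$, with $\widetilde V(E\otimes\mathcal M)\subseteq\mathcal M$; 6. there is a closed subspace $\mathcal M\supseteq\mathcal E$, $\mathcal M\neq\mathcal H$, with $E\otimes\mathcal M\subseteq\widetilde V^\dagger\mathcal M$; 7. there are closed subspaces $\mathcal M_1,\mathcal M_2$ of $\mathcal H$ with $\mathcal M_2\neq\{0\}$, $\widetilde V(E\otimes\mathcal M_1)\subseteq\mathcal M_1$, $\widetilde V^\dagger(\mathcal M_1)\subseteq E\otimes(\mathcal M_1\oplus\mathcal E)$, $P_{\mathcal M_2}\widetilde V(E\otimes\mathcal M_2)=\mathcal M_2$ and $R(\widetilde V)=\mathcal M_1\oplus\mathcal M_2$, where $P_{\mathcal M_2}$ is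 the orthogonal projection of $\mathcal H$ onto $\mathcal M_2$. Moreover, if $E\otimes\mathcal E\neq\{0\}$, then these conditions are also equivalent to 7 with both $\mathcal M_1$ and $\mathcal M_2$ required to be non-zero. -/

import Mathlib

universe v u

noncomputable section

open scoped TensorProduct ComplexOrder InnerProductSpace

/-- A `C*`-correspondence `E` over `B`: a (right) Hilbert `C*`-module over the `C*`-algebra `B`
(complete, by the assumption `[CompleteSpace E]` where it matters) with a nondegenerate left action
of `B` by adjointable operators.  The inner product is linear in the second variable.  (The module
axioms for the right action, and boundedness and right-linearity of the left action, are consequences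
of the laws below, because the inner product is definite.) -/
structure CStarCorrespondence (B : Type v) (E : Type u) [NonUnitalCStarAlgebra B] [PartialOrder B]
    [StarOrderedRing B] [NormedAddCommGroup E] [NormedSpace ℂ E] where
  /-- the `B`-valued inner product -/
  inn : E → E → B
  /-- the right action `ξ · b` -/
  ract : E → B → E
  /-- the left action `φ(b)` -/
  lact : B →ₙₐ[ℂ] Module.End ℂ E
  inn_add_right : ∀ ξ η ζ, inn ξ (η + ζ) = inn ξ η + inn ξ ζ
  inn_smul_right : ∀ (c : ℂ) ξ η, inn ξ (c • η) = c • inn ξ η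
  star_inn : ∀ ξ η, star (inn ξ η) = inn η ξ
  inn_self_nonneg : ∀ ξ, 0 ≤ inn ξ ξ
  norm_sq_eq : ∀ ξ, ‖ξ‖ ^ 2 = ‖inn ξ ξ‖
  inn_ract : ∀ ξ η b, inn ξ (ract η b) = inn ξ η * b
  inn_lact : ∀ b ξ η, inn (lact b ξ) η = inn ξ (lact (star b) η)
  lact_nondegenerate :
    (Submodule.span ℂ {x : E | ∃ b ξ, x = lact b ξ}).topologicalClosure = ⊤

/-- A Hilbert space with a representation (`*`-homomorphism into the bounded operators) of `B`. -/
structure HilbertRep (B : Type v) [NonUnitalCStarAlgebra B] where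
  carrier : Type u
  [grp : NormedAddCommGroup carrier]
  [ips : InnerProductSpace ℂ carrier]
  [cpl : CompleteSpace carrier]
  rep : B →⋆ₙₐ[ℂ] (carrier →L[ℂ] carrier)

namespace HilbertRep

instance (B : Type v) [NonUnitalCStarAlgebra B] :
    CoeSort (HilbertRep.{v, u} B) (Type u) := ⟨HilbertRep.carrier⟩

instance {B : Type v} [NonUnitalCStarAlgebra B] (X : HilbertRep.{v, u} B) :
    NormedAddCommGroup X := X.grp

instance {B : Type v} [NonUnitalCStarAlgebra B] (X : HilbertRep.{v, u} B) :
    InnerProductSpace ℂ X := X.ips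

instance {B : Type v} [NonUnitalCStarAlgebra B] (X : HilbertRep.{v, u} B) :
    CompleteSpace X := X.cpl

theorem inner_rep_left {B : Type v} [NonUnitalCStarAlgebra B] (X : HilbertRep.{v, u} B) (b : B)
    (x y : X) : ⟪X.rep b x, y⟫_ℂ = ⟪x, X.rep (star b) y⟫_ℂ := by
  rw [map_star, ContinuousLinearMap.star_eq_adjoint, ContinuousLinearMap.adjoint_inner_right]

end HilbertRep

namespace CStarCorrespondence

variable {B : Type v} {E : Type u} [NonUnitalCStarAlgebra B] [PartialOrder B]
  [StarOrderedRing B] [NormedAddCommGroup E] [NormedSpace ℂ E]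
  (C : CStarCorrespondence B E)

theorem inn_add_left (ξ η ζ : E) : C.inn (ξ + η) ζ = C.inn ξ ζ + C.inn η ζ := by
  rw [← C.star_inn, C.inn_add_right, star_add, C.star_inn, C.star_inn]

theorem inn_smul_left (c : ℂ) (ξ η : E) : C.inn (c • ξ) η = star c • C.inn ξ η := by
  rw [← C.star_inn, C.inn_smul_right, star_smul, C.star_inn]

theorem inn_zero_right (ξ : E) : C.inn ξ 0 = 0 := by
  have := C.inn_smul_right 0 ξ 0
  simpa using this

theorem inn_zero_left (ξ : E) : C.inn 0 ξ = 0 := by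
  rw [← C.star_inn, C.inn_zero_right, star_zero]

theorem inn_sum_right {ι : Type*} (s : Finset ι) (ξ : E) (f : ι → E) :
    C.inn ξ (∑ i ∈ s, f i) = ∑ i ∈ s, C.inn ξ (f i) := by
  classical
  induction s using Finset.induction_on with
  | empty => simp [C.inn_zero_right]
  | insert a s ha ih => rw [Finset.sum_insert ha, Finset.sum_insert ha, C.inn_add_right, ih]

theorem inn_sum_left {ι : Type*} (s : Finset ι) (ξ : E) (f : ι → E) :
    C.inn (∑ i ∈ s, f i) ξ = ∑ i ∈ s, C.inn (f i) ξ := by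
  rw [← C.star_inn, C.inn_sum_right, star_sum]
  simp [C.star_inn]

theorem inn_ract_left (ξ η : E) (b : B) : C.inn (C.ract ξ b) η = star b * C.inn ξ η := by
  rw [← C.star_inn, C.inn_ract, star_mul, C.star_inn]

/-- The matrix of inner products of a finite family. -/
def gram {ι : Type*} (ξ : ι → E) : CStarMatrix ι ι B :=
  CStarMatrix.ofMatrix fun i j => C.inn (ξ i) (ξ j)

theorem gram_apply {ι : Type*} (ξ : ι → E) (i j : ι) : C.gram ξ i j = C.inn (ξ i) (ξ j) := rfl

theorem gram_isSelfAdjoint {ι : Type*} (ξ : ι → E) :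
    IsSelfAdjoint (C.gram ξ) := by
  ext i j
  simp [CStarMatrix.star_apply, gram_apply, C.star_inn]

theorem star_mul_gram_mul {ι : Type*} [Fintype ι] (ξ : ι → E) (c : CStarMatrix ι ι B) :
    star c * C.gram ξ * c = C.gram fun i => ∑ k, C.ract (ξ k) (c k i) := by
  ext i j
  simp only [CStarMatrix.mul_apply, gram_apply, CStarMatrix.star_apply, C.inn_sum_right,
    C.inn_sum_left, C.inn_ract, C.inn_ract_left, Finset.sum_mul]

theorem eq_zero_of_diag_nonpos {ι : Type*} [Fintype ι] (d : CStarMatrix ι ι B)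
    (h : ∀ i, (star d * d) i i ≤ 0) : d = 0 := by
  ext k i
  have h0 : ∀ l, 0 ≤ star (d l i) * d l i := fun l => star_mul_self_nonneg _
  have h1 : ∑ l, star (d l i) * d l i ≤ 0 := by
    simpa [CStarMatrix.mul_apply, CStarMatrix.star_apply] using h i
  have h2 := le_trans (Finset.single_le_sum (fun l _ => h0 l) (Finset.mem_univ k)) h1
  have h3 := le_antisymm h2 (h0 k)
  simpa using h3

theorem exists_star_mul_self {D : Type*} [NonUnitalCStarAlgebra D] [PartialOrder D]
    [StarOrderedRing D] {m : D} (hm : 0 ≤ m) : ∃ r : D, m = star r * r :=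
  CStarAlgebra.nonneg_iff_eq_star_mul_self.1 hm

theorem exists_negPart {D : Type*} [NonUnitalCStarAlgebra D] [PartialOrder D] [StarOrderedRing D]
    (m : D) (hm : IsSelfAdjoint m) :
    ∃ n : D, 0 ≤ n ∧ n * m = -(n * n) ∧ (n = 0 → 0 ≤ m) := by
  refine ⟨m⁻, CFC.negPart_nonneg m, ?_, (CFC.negPart_eq_zero_iff m hm).1⟩
  nth_rewrite 2 [← CFC.posPart_sub_negPart m hm]
  rw [mul_sub, CFC.negPart_mul_posPart, zero_sub]

theorem gram_nonneg {ι : Type*} [Fintype ι] (ξ : ι → E) : 0 ≤ C.gram ξ := by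
  classical
  obtain ⟨n, hn, hnm, hn0⟩ := exists_negPart (C.gram ξ) (C.gram_isSelfAdjoint ξ)
  apply hn0
  have hsa : star n = n := (IsSelfAdjoint.of_nonneg hn).star_eq
  obtain ⟨r, hr⟩ := exists_star_mul_self hn
  have key : star n * C.gram ξ * n = -(star (r * n) * (r * n)) := by
    rw [hsa, hnm, star_mul, hsa]
    have : n * star r * (r * n) = n * (star r * r) * n := by simp only [mul_assoc]
    rw [this, ← hr, neg_mul]
  have hz : r * n = 0 := by
    apply eq_zero_of_diag_nonpos
    intro i
    have h1 : 0 ≤ (star n * C.gram ξ * n) i i := by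
      rw [star_mul_gram_mul, gram_apply]
      exact C.inn_self_nonneg _
    rw [key, CStarMatrix.neg_apply] at h1
    simpa using h1
  have h1 : n * n = 0 := by
    nth_rewrite 1 [hr]
    rw [mul_assoc, hz, mul_zero]
  have h2 : star n * n = 0 := by rw [hsa, h1]
  simpa using h2

theorem exists_gram_eq {ι : Type*} [Fintype ι] (ξ : ι → E) :
    ∃ r : ι → ι → B, ∀ i j, C.inn (ξ i) (ξ j) = ∑ k, star (r k i) * r k j := by
  classical
  obtain ⟨r, hr⟩ := exists_star_mul_self (C.gram_nonneg ξ)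
  refine ⟨fun k i => r k i, fun i j => ?_⟩
  rw [← gram_apply, hr]
  simp [CStarMatrix.mul_apply, CStarMatrix.star_apply]

/-! ### The interior tensor product `E ⊗_σ H` -/

/-- The algebraic tensor product carrying the semi-inner product
`⟪ξ ⊗ x, η ⊗ y⟫ = ⟪x, σ(⟨ξ, η⟩) y⟫`. -/
def PreTensor (_C : CStarCorrespondence B E) (X : HilbertRep.{v, u} B) : Type u := E ⊗[ℂ] X

instance (X : HilbertRep.{v, u} B) : AddCommGroup (C.PreTensor X) :=
  inferInstanceAs (AddCommGroup (E ⊗[ℂ] X))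

instance (X : HilbertRep.{v, u} B) : Module ℂ (C.PreTensor X) :=
  inferInstanceAs (Module ℂ (E ⊗[ℂ] X))

/-- The elementary tensor in the algebraic tensor product. -/
def ptmul (X : HilbertRep.{v, u} B) (ξ : E) (x : X) : C.PreTensor X := ξ ⊗ₜ[ℂ] x

/-- The linear functional `η ⊗ y ↦ ⟪x, σ(⟨ξ, η⟩) y⟫`. -/
def preFormRight (X : HilbertRep.{v, u} B) (ξ : E) (x : X) : E ⊗[ℂ] X →ₗ[ℂ] ℂ :=
  TensorProduct.lift (LinearMap.mk₂ ℂ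
    (fun (η : E) (y : X) => ⟪x, X.rep (C.inn ξ η) y⟫_ℂ)
    (by intro η η' y; simp [C.inn_add_right])
    (by intro c η y; simp [C.inn_smul_right])
    (by intro η y y'; simp)
    (by intro c η y; simp))

theorem preFormRight_tmul (X : HilbertRep.{v, u} B) (ξ η : E) (x y : X) :
    C.preFormRight X ξ x (η ⊗ₜ[ℂ] y) = ⟪x, X.rep (C.inn ξ η) y⟫_ℂ := rfl

/-- The semi-inner product on the algebraic tensor product, as a sesquilinear map on `E ⊗[ℂ] X`. -/
def preFormAux (X : HilbertRep.{v, u} B) : E ⊗[ℂ] X →ₗ⋆[ℂ] E ⊗[ℂ] X →ₗ[ℂ] ℂ :=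
  TensorProduct.lift (LinearMap.mk₂'ₛₗ (starRingEnd ℂ) (starRingEnd ℂ) (C.preFormRight X)
    (by
      intro ξ ξ' x
      apply TensorProduct.ext'
      intro η y
      simp [C.inn_add_left, preFormRight_tmul])
    (by
      intro c ξ x
      apply TensorProduct.ext'
      intro η y
      simp [C.inn_smul_left, preFormRight_tmul])
    (by
      intro ξ x x'
      apply TensorProduct.ext'
      intro η y
      simp [preFormRight_tmul])
    (by
      intro c ξ x
      apply TensorProduct.ext'
      intro η y
      simp [preFormRight_tmul, mul_comm]))

/-- The semi-inner product on the algebraic tensor product as a sesquilinear map. -/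
def preForm (X : HilbertRep.{v, u} B) : C.PreTensor X →ₗ⋆[ℂ] C.PreTensor X →ₗ[ℂ] ℂ :=
  C.preFormAux X

theorem preForm_ptmul (X : HilbertRep.{v, u} B) (ξ η : E) (x y : X) :
    C.preForm X (C.ptmul X ξ x) (C.ptmul X η y) = ⟪x, X.rep (C.inn ξ η) y⟫_ℂ := rfl

variable {C} in
theorem PreTensor.induction {X : HilbertRep.{v, u} B} {p : C.PreTensor X → Prop}
    (z : C.PreTensor X) (h0 : p 0) (ht : ∀ ξ x, p (C.ptmul X ξ x))
    (ha : ∀ a b, p a → p b → p (a + b)) : p z :=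
  TensorProduct.induction_on z h0 ht ha

theorem exists_sum (X : HilbertRep.{v, u} B) (z : C.PreTensor X) :
    ∃ S : Finset (E × X), z = ∑ i : S, C.ptmul X i.1.1 i.1.2 := by
  obtain ⟨S, hS⟩ := TensorProduct.exists_finset (R := ℂ) (M := E) (N := X) z
  exact ⟨S, hS.trans (Finset.sum_coe_sort S fun i => C.ptmul X i.1 i.2).symm⟩

theorem preForm_symm (X : HilbertRep.{v, u} B) (z w : C.PreTensor X) :
    starRingEnd ℂ (C.preForm X w z) = C.preForm X z w := by
  induction z using PreTensor.induction with
  | h0 => simp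
  | ha a b ha hb => simp [ha, hb]
  | ht ξ x =>
    induction w using PreTensor.induction with
    | h0 => simp
    | ha a b ha hb => simp [ha, hb]
    | ht η y =>
      rw [preForm_ptmul, preForm_ptmul, inner_conj_symm, X.inner_rep_left, C.star_inn]

theorem preForm_sum {ι : Type*} [Fintype ι] (X : HilbertRep.{v, u} B) (ξ η : ι → E) (x y : ι → X) :
    C.preForm X (∑ i, C.ptmul X (ξ i) (x i)) (∑ i, C.ptmul X (η i) (y i)) =
      ∑ i, ∑ j, ⟪x i, X.rep (C.inn (ξ i) (η j)) (y j)⟫_ℂ := by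
  simp only [map_sum, LinearMap.sum_apply, preForm_ptmul]
  exact Finset.sum_comm

theorem ofReal_norm_sq {F : Type*} [NormedAddCommGroup F] [InnerProductSpace ℂ F] (w : F) :
    ((‖w‖ ^ 2 : ℝ) : ℂ) = ⟪w, w⟫_ℂ := by
  rw [inner_self_eq_norm_sq_to_K]
  simp

theorem preForm_self_sum {ι : Type*} [Fintype ι] (X : HilbertRep.{v, u} B) (ξ : ι → E)
    (x : ι → X) (r : ι → ι → B)
    (hr : ∀ i j, C.inn (ξ i) (ξ j) = ∑ k, star (r k i) * r k j) :
    C.preForm X (∑ i, C.ptmul X (ξ i) (x i)) (∑ i, C.ptmul X (ξ i) (x i)) =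
      ((∑ k, ‖∑ j, X.rep (r k j) (x j)‖ ^ 2 : ℝ) : ℂ) := by
  have h1 : ∀ k, ((‖∑ j, X.rep (r k j) (x j)‖ ^ 2 : ℝ) : ℂ) =
      ∑ i, ∑ j, ⟪x i, X.rep (star (r k i) * r k j) (x j)⟫_ℂ := by
    intro k
    generalize hv : (fun j => X.rep (r k j) (x j)) = v
    have hv' : ∀ j, X.rep (r k j) (x j) = v j := fun j => congrFun hv j
    have h2 : ∀ i j, ⟪x i, X.rep (star (r k i) * r k j) (x j)⟫_ℂ = ⟪v i, v j⟫_ℂ := by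
      intro i j
      rw [← hv', ← hv', X.inner_rep_left, map_mul]
      rfl
    simp only [h2]
    rw [ofReal_norm_sq, sum_inner]
    exact Finset.sum_congr rfl fun i _ => inner_sum _ _ _
  have h3 : ∀ i j, ⟪x i, X.rep (C.inn (ξ i) (ξ j)) (x j)⟫_ℂ =
      ∑ k, ⟪x i, X.rep (star (r k i) * r k j) (x j)⟫_ℂ := by
    intro i j
    rw [hr, map_sum, sum_apply, inner_sum]
  rw [preForm_sum, Complex.ofReal_sum, Finset.sum_congr rfl fun k _ => h1 k,
    Finset.sum_congr rfl fun i _ => Finset.sum_congr rfl fun j _ => h3 i j]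
  rw [Finset.sum_comm]
  refine (Finset.sum_congr rfl fun i _ => Finset.sum_comm).trans ?_
  rw [Finset.sum_comm]
  exact Finset.sum_congr rfl fun k _ => Finset.sum_comm

theorem preForm_self_nonneg (X : HilbertRep.{v, u} B) (z : C.PreTensor X) :
    0 ≤ C.preForm X z z := by
  obtain ⟨S, rfl⟩ := C.exists_sum X z
  obtain ⟨r, hr⟩ := C.exists_gram_eq (fun i : S => i.1.1)
  rw [C.preForm_self_sum X _ _ r hr]
  rw [Complex.zero_le_real]
  positivity

/-- The semi-inner product structure. -/
@[reducible]
def preCore (X : HilbertRep.{v, u} B) : PreInnerProductSpace.Core ℂ (C.PreTensor X) where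
  inner z w := C.preForm X z w
  conj_inner_symm z w := C.preForm_symm X z w
  re_inner_nonneg z := (Complex.le_def.1 (C.preForm_self_nonneg X z)).1
  add_left z w t := by simp
  smul_left z w c := by simp

instance (X : HilbertRep.{v, u} B) : SeminormedAddCommGroup (C.PreTensor X) :=
  letI := C.preCore X
  InnerProductSpace.Core.toSeminormedAddCommGroup (𝕜 := ℂ)

instance (X : HilbertRep.{v, u} B) : InnerProductSpace ℂ (C.PreTensor X) :=
  InnerProductSpace.ofCore (C.preCore X)

theorem pre_inner_def (X : HilbertRep.{v, u} B) (z w : C.PreTensor X) :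
    ⟪z, w⟫_ℂ = C.preForm X z w := rfl

end CStarCorrespondence
/-- A bounded operator between representation spaces commuting with the actions of `B`. -/
structure Intertwiner {B : Type v} [NonUnitalCStarAlgebra B] (X Y : HilbertRep.{v, u} B) where
  op : X →L[ℂ] Y
  op_rep : ∀ b x, op (X.rep b x) = Y.rep b (op x)

namespace CStarCorrespondence

variable {B : Type v} {E : Type u} [NonUnitalCStarAlgebra B] [PartialOrder B]
  [StarOrderedRing B] [NormedAddCommGroup E] [NormedSpace ℂ E]
  (C : CStarCorrespondence B E)

theorem ofReal_norm_sq_pre (X : HilbertRep.{v, u} B) (z : C.PreTensor X) :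
    ((‖z‖ ^ 2 : ℝ) : ℂ) = C.preForm X z z := by
  have h : ⟪z, z⟫_ℂ = _ := inner_self_eq_norm_sq_to_K (𝕜 := ℂ) z
  rw [pre_inner_def] at h
  rw [h]
  simp

/-- `id ⊗ T` on algebraic tensors. -/
def preMap {X Y : HilbertRep.{v, u} B} (T : Intertwiner X Y) : C.PreTensor X →ₗ[ℂ] C.PreTensor Y :=
  TensorProduct.map LinearMap.id T.op.toLinearMap

theorem preMap_ptmul {X Y : HilbertRep.{v, u} B} (T : Intertwiner X Y) (ξ : E) (x : X) :
    C.preMap T (C.ptmul X ξ x) = C.ptmul Y ξ (T.op x) := rfl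

theorem norm_preMap_le {X Y : HilbertRep.{v, u} B} (T : Intertwiner X Y) (z : C.PreTensor X) :
    ‖C.preMap T z‖ ≤ ‖T.op‖ * ‖z‖ := by
  apply le_of_sq_le_sq _ (by positivity)
  obtain ⟨S, rfl⟩ := C.exists_sum X z
  obtain ⟨r, hr⟩ := C.exists_gram_eq (fun i : S => i.1.1)
  rw [map_sum, mul_pow]
  simp only [preMap_ptmul]
  have h1 := (C.ofReal_norm_sq_pre _ _).trans
    (C.preForm_self_sum X (fun i : S => i.1.1) (fun i : S => i.1.2) r hr)
  have h2 := (C.ofReal_norm_sq_pre _ _).trans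
    (C.preForm_self_sum Y (fun i : S => i.1.1) (fun i : S => T.op i.1.2) r hr)
  rw [Complex.ofReal_inj] at h1 h2
  rw [h1, h2, Finset.mul_sum]
  refine Finset.sum_le_sum fun k _ => ?_
  have h3 : ∑ j : S, Y.rep (r k j) (T.op j.1.2) = T.op (∑ j : S, X.rep (r k j) j.1.2) := by
    rw [map_sum]
    exact Finset.sum_congr rfl fun j _ => (T.op_rep _ _).symm
  rw [h3, ← mul_pow]
  gcongr
  exact T.op.le_opNorm _

/-- `φ(b) ⊗ id` on algebraic tensors. -/
def preAct (X : HilbertRep.{v, u} B) (b : B) : C.PreTensor X →ₗ[ℂ] C.PreTensor X :=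
  TensorProduct.map (C.lact b) LinearMap.id

theorem preAct_ptmul (X : HilbertRep.{v, u} B) (b : B) (ξ : E) (x : X) :
    C.preAct X b (C.ptmul X ξ x) = C.ptmul X (C.lact b ξ) x := rfl

theorem preAct_mul (X : HilbertRep.{v, u} B) (b c : B) (z : C.PreTensor X) :
    C.preAct X (b * c) z = C.preAct X b (C.preAct X c z) := by
  induction z using PreTensor.induction with
  | h0 => simp
  | ha a b ha hb => simp [ha, hb]
  | ht ξ x => rw [preAct_ptmul, preAct_ptmul, preAct_ptmul, map_mul, Module.End.mul_apply]

theorem ptmul_add_left (X : HilbertRep.{v, u} B) (ξ η : E) (x : X) :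
    C.ptmul X (ξ + η) x = C.ptmul X ξ x + C.ptmul X η x := TensorProduct.add_tmul _ _ _

theorem ptmul_smul_left (X : HilbertRep.{v, u} B) (c : ℂ) (ξ : E) (x : X) :
    C.ptmul X (c • ξ) x = c • C.ptmul X ξ x := (TensorProduct.smul_tmul' _ _ _).symm

theorem preAct_add (X : HilbertRep.{v, u} B) (b c : B) (z : C.PreTensor X) :
    C.preAct X (b + c) z = C.preAct X b z + C.preAct X c z := by
  induction z using PreTensor.induction with
  | h0 => simp
  | ha a b ha hb => simp only [map_add, ha, hb]; abel
  | ht ξ x => rw [preAct_ptmul, preAct_ptmul, preAct_ptmul, map_add, LinearMap.add_apply,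
      ptmul_add_left]

theorem preAct_smul (X : HilbertRep.{v, u} B) (c : ℂ) (b : B) (z : C.PreTensor X) :
    C.preAct X (c • b) z = c • C.preAct X b z := by
  induction z using PreTensor.induction with
  | h0 => simp
  | ha a b ha hb => simp only [map_add, ha, hb, smul_add]
  | ht ξ x => rw [preAct_ptmul, preAct_ptmul, map_smul, LinearMap.smul_apply, ptmul_smul_left]

theorem preForm_preAct (X : HilbertRep.{v, u} B) (b : B) (z w : C.PreTensor X) :
    C.preForm X (C.preAct X b z) w = C.preForm X z (C.preAct X (star b) w) := by
  induction z using PreTensor.induction with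
  | h0 => simp
  | ha a b ha hb => simp [ha, hb]
  | ht ξ x =>
    induction w using PreTensor.induction with
    | h0 => simp
    | ha a b ha hb => simp only [map_add, ha, hb]
    | ht η y => rw [preAct_ptmul, preAct_ptmul, preForm_ptmul, preForm_ptmul, C.inn_lact]

theorem exists_sub_eq {D : Type*} [NonUnitalCStarAlgebra D] [PartialOrder D] [StarOrderedRing D]
    (a : D) (ha : 0 ≤ a) (h0 : 0 < ‖a‖) :
    ∃ g : D, star g = g ∧ g + g - g * g = ((‖a‖⁻¹ : ℝ) : ℂ) • a := by
  set d := ‖a‖ with hd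
  set f : ℝ → ℝ := fun t => 1 - √(1 - d⁻¹ * t) with hf
  have hf0 : f 0 = 0 := by simp [hf]
  have hfc : Continuous f := by fun_prop
  have hsa : IsSelfAdjoint a := .of_nonneg ha
  refine ⟨cfcₙ f a, (cfcₙ_predicate f a : IsSelfAdjoint _).star_eq, ?_⟩
  rw [← cfcₙ_add (R := ℝ) f f a, ← cfcₙ_mul (R := ℝ) f f a, ← cfcₙ_sub (R := ℝ) _ _ a]
  have h1 : cfcₙ (fun t : ℝ => f t + f t - f t * f t) a = cfcₙ (fun t : ℝ => d⁻¹ * t) a := by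
    refine cfcₙ_congr fun t ht => ?_
    have h2 : t ≤ d := (le_abs_self t).trans (NonUnitalIsometricContinuousFunctionalCalculus.norm_quasispectrum_le a ht hsa)
    have h3 : 0 ≤ 1 - d⁻¹ * t := by
      have : d⁻¹ * t ≤ d⁻¹ * d := by gcongr
      rw [inv_mul_cancel₀ h0.ne'] at this
      linarith
    have h4 := Real.mul_self_sqrt h3
    simp only [hf]
    linear_combination -h4
  rw [h1, cfcₙ_const_mul_id (R := ℝ) d⁻¹ a hsa]
  exact (Complex.coe_smul _ _).symm

theorem norm_preAct_le (X : HilbertRep.{v, u} B) (b : B) (z : C.PreTensor X) :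
    ‖C.preAct X b z‖ ≤ ‖b‖ * ‖z‖ := by
  apply le_of_sq_le_sq _ (by positivity)
  rcases (norm_nonneg (star b * b)).eq_or_lt' with h0 | h0
  · have hb : b = 0 := by simpa using h0
    have : C.preAct X b z = 0 := by
      rw [hb]
      simpa using C.preAct_smul X 0 0 z
    rw [this, hb]
    simp
  · obtain ⟨g, hg, hga⟩ := exists_sub_eq (star b * b) (star_mul_self_nonneg b) h0
    have h1 := C.preForm_self_nonneg X (z - C.preAct X g z)
    have h2 : C.preForm X (z - C.preAct X g z) (z - C.preAct X g z) =
        C.preForm X z z - C.preForm X z (C.preAct X (g + g - g * g) z) := by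
      rw [sub_eq_add_neg (g + g), preAct_add, preAct_add, ← neg_one_smul ℂ (g * g), preAct_smul,
        preAct_mul]
      simp only [map_sub, map_add, map_smul, LinearMap.sub_apply, preForm_preAct, hg]
      simp only [smul_eq_mul]
      ring
    have h3 : C.preForm X z (C.preAct X (g + g - g * g) z) =
        ((‖star b * b‖⁻¹ * ‖C.preAct X b z‖ ^ 2 : ℝ) : ℂ) := by
      rw [hga, preAct_smul, map_smul, preAct_mul, ← preForm_preAct, Complex.ofReal_mul,
        ofReal_norm_sq_pre, smul_eq_mul]
    rw [h2, h3, ← ofReal_norm_sq_pre, ← Complex.ofReal_sub, Complex.zero_le_real] at h1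
    have h4 : ‖star b * b‖ = ‖b‖ ^ 2 := by rw [CStarRing.norm_star_mul_self, sq]
    rw [mul_pow, ← h4]
    rw [sub_nonneg, inv_mul_le_iff₀ h0] at h1
    exact h1

/-- The action of `b` on the completed tensor product. -/
def actCompletion (X : HilbertRep.{v, u} B) (b : B) :
    UniformSpace.Completion (C.PreTensor X) →L[ℂ] UniformSpace.Completion (C.PreTensor X) :=
  ((C.preAct X b).mkContinuous ‖b‖ (C.norm_preAct_le X b)).completion

theorem actCompletion_coe (X : HilbertRep.{v, u} B) (b : B) (z : C.PreTensor X) :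
    C.actCompletion X b (z : UniformSpace.Completion (C.PreTensor X)) =
      (C.preAct X b z : UniformSpace.Completion (C.PreTensor X)) :=
  ContinuousLinearMap.completion_apply_coe _ _

theorem completion_ext (X : HilbertRep.{v, u} B) {F : Type*} [NormedAddCommGroup F]
    [NormedSpace ℂ F] {S T : UniformSpace.Completion (C.PreTensor X) →L[ℂ] F}
    (h : ∀ z : C.PreTensor X, S z = T z) : S = T := by
  ext z
  induction z using UniformSpace.Completion.induction_on with
  | hp => exact isClosed_eq S.continuous T.continuous
  | ih z => exact h z

theorem actCompletion_adjoint (X : HilbertRep.{v, u} B) (b : B)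
    (z w : UniformSpace.Completion (C.PreTensor X)) :
    ⟪C.actCompletion X (star b) z, w⟫_ℂ = ⟪z, C.actCompletion X b w⟫_ℂ := by
  induction z, w using UniformSpace.Completion.induction_on₂ with
  | hp =>
    exact isClosed_eq (Continuous.inner ((C.actCompletion X (star b)).continuous.comp
      continuous_fst) continuous_snd) (Continuous.inner continuous_fst
      ((C.actCompletion X b).continuous.comp continuous_snd))
  | ih z w =>
    rw [actCompletion_coe, actCompletion_coe, UniformSpace.Completion.inner_coe,
      UniformSpace.Completion.inner_coe, pre_inner_def, pre_inner_def, preForm_preAct, star_star]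

/-- The representation `b ↦ φ(b) ⊗ I` on the completed tensor product. -/
def tensorRep (X : HilbertRep.{v, u} B) : B →⋆ₙₐ[ℂ]
    (UniformSpace.Completion (C.PreTensor X) →L[ℂ] UniformSpace.Completion (C.PreTensor X)) where
  toFun := C.actCompletion X
  map_smul' c b := C.completion_ext X fun z => by
    refine (C.actCompletion_coe X _ z).trans ?_
    rw [preAct_smul, UniformSpace.Completion.coe_smul, ← actCompletion_coe]
    rfl
  map_zero' := C.completion_ext X fun z => by
    refine (C.actCompletion_coe X _ z).trans ?_
    rw [← zero_smul ℂ (0 : B), preAct_smul, zero_smul, UniformSpace.Completion.coe_zero]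
    rfl
  map_add' b c := C.completion_ext X fun z => by
    refine (C.actCompletion_coe X _ z).trans ?_
    rw [preAct_add, UniformSpace.Completion.coe_add, ← actCompletion_coe, ← actCompletion_coe]
    rfl
  map_mul' b c := C.completion_ext X fun z => by
    refine (C.actCompletion_coe X _ z).trans ?_
    rw [preAct_mul, ← actCompletion_coe, ← actCompletion_coe]
    rfl
  map_star' b := by
    rw [ContinuousLinearMap.star_eq_adjoint, ContinuousLinearMap.eq_adjoint_iff]
    exact C.actCompletion_adjoint X b

/-- The interior tensor product `E ⊗_σ H`: the Hilbert space completion of the algebraic tensor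
product for the semi-inner product above, with the representation `b ↦ φ(b) ⊗ I`. -/
def tensor (X : HilbertRep.{v, u} B) : HilbertRep.{v, u} B where
  carrier := UniformSpace.Completion (C.PreTensor X)
  rep := C.tensorRep X

/-- The elementary tensor `ξ ⊗ x` in `E ⊗_σ H`. -/
def tmul (X : HilbertRep.{v, u} B) (ξ : E) (x : X) : C.tensor X :=
  (C.ptmul X ξ x : UniformSpace.Completion (C.PreTensor X))

theorem inner_tmul (X : HilbertRep.{v, u} B) (ξ η : E) (x y : X) :
    ⟪C.tmul X ξ x, C.tmul X η y⟫_ℂ = ⟪x, X.rep (C.inn ξ η) y⟫_ℂ :=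
  (UniformSpace.Completion.inner_coe _ _).trans (C.preForm_ptmul X ξ η x y)

theorem rep_tmul (X : HilbertRep.{v, u} B) (b : B) (ξ : E) (x : X) :
    (C.tensor X).rep b (C.tmul X ξ x) = C.tmul X (C.lact b ξ) x :=
  (C.actCompletion_coe X b _).trans rfl

theorem tensor_ext (X : HilbertRep.{v, u} B) {F : Type*} [NormedAddCommGroup F] [NormedSpace ℂ F]
    {S T : C.tensor X →L[ℂ] F} (h : ∀ ξ x, S (C.tmul X ξ x) = T (C.tmul X ξ x)) : S = T := by
  refine C.completion_ext X fun z => ?_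
  induction z using PreTensor.induction with
  | h0 =>
    rw [UniformSpace.Completion.coe_zero]
    exact (map_zero S).trans (map_zero T).symm
  | ht ξ x => exact h ξ x
  | ha a b ha hb =>
    rw [UniformSpace.Completion.coe_add]
    exact (map_add S _ _).trans ((congrArg₂ (· + ·) ha hb).trans (map_add T _ _).symm)

/-- `I_E ⊗ T` as a bounded operator. -/
def mapCLM {X Y : HilbertRep.{v, u} B} (T : Intertwiner X Y) : C.tensor X →L[ℂ] C.tensor Y :=
  ((C.preMap T).mkContinuous ‖T.op‖ (C.norm_preMap_le T)).completion

theorem mapCLM_tmul {X Y : HilbertRep.{v, u} B} (T : Intertwiner X Y) (ξ : E) (x : X) :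
    C.mapCLM T (C.tmul X ξ x) = C.tmul Y ξ (T.op x) :=
  (ContinuousLinearMap.completion_apply_coe _ _).trans rfl

/-- The operator `I_E ⊗ T : E ⊗ X → E ⊗ Y` for an intertwiner `T : X → Y`. -/
def map {X Y : HilbertRep.{v, u} B} (T : Intertwiner X Y) :
    Intertwiner (C.tensor X) (C.tensor Y) where
  op := C.mapCLM T
  op_rep b := DFunLike.congr_fun (F := C.tensor X →L[ℂ] C.tensor Y)
    (f := (C.mapCLM T).comp ((C.tensor X).rep b)) (g := ((C.tensor Y).rep b).comp (C.mapCLM T))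
    (C.tensor_ext X fun ξ x => by
      simp only [ContinuousLinearMap.comp_apply, rep_tmul, mapCLM_tmul])

theorem map_tmul {X Y : HilbertRep.{v, u} B} (T : Intertwiner X Y) (ξ : E) (x : X) :
    (C.map T).op (C.tmul X ξ x) = C.tmul Y ξ (T.op x) := C.mapCLM_tmul T ξ x

end CStarCorrespondence
/-! ### Operators on representation spaces -/

/-- The four equations characterizing the Moore-Penrose inverse `S` of `T`. -/
structure IsMoorePenrose {X Y : Type*} [NormedAddCommGroup X] [InnerProductSpace ℂ X]
    [CompleteSpace X] [NormedAddCommGroup Y] [InnerProductSpace ℂ Y] [CompleteSpace Y]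
    (T : X →L[ℂ] Y) (S : Y →L[ℂ] X) : Prop where
  mul_inv_mul : T ∘L S ∘L T = T
  inv_mul_inv : S ∘L T ∘L S = S
  mul_inv_selfAdjoint : IsSelfAdjoint (T ∘L S)
  inv_mul_selfAdjoint : IsSelfAdjoint (S ∘L T)

open Classical in
/-- The Moore-Penrose inverse of a bounded operator (it exists and is unique when the range is
closed, see `moorePenrose_spec`; the value is `0` if there is none). -/
def moorePenrose {X Y : Type*} [NormedAddCommGroup X] [InnerProductSpace ℂ X]
    [CompleteSpace X] [NormedAddCommGroup Y] [InnerProductSpace ℂ Y] [CompleteSpace Y]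
    (T : X →L[ℂ] Y) : Y →L[ℂ] X :=
  if h : ∃ S, IsMoorePenrose T S then h.choose else 0

theorem moorePenrose_spec {X Y : Type*} [NormedAddCommGroup X] [InnerProductSpace ℂ X]
    [CompleteSpace X] [NormedAddCommGroup Y] [InnerProductSpace ℂ Y] [CompleteSpace Y]
    (T : X →L[ℂ] Y) (hT : IsClosed (T.range : Set Y)) :
    IsMoorePenrose T (moorePenrose T) := by
  suffices h : ∃ S, IsMoorePenrose T S by
    rw [moorePenrose, dif_pos h]
    exact h.choose_spec
  have : CompleteSpace T.range := hT.completeSpace_coe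
  have : CompleteSpace T.ker := T.isClosed_ker.completeSpace_coe
  let T₀ : T.kerᗮ →L[ℂ] T.range :=
    (T ∘L T.kerᗮ.subtypeL).codRestrict T.range fun x => ⟨x, rfl⟩
  have hdec : ∀ x : X, T (T.kerᗮ.starProjection x) = T x := by
    intro x
    have h1 : x - T.kerᗮ.starProjection x ∈ T.ker := by
      have := Submodule.sub_starProjection_mem_orthogonal (K := T.kerᗮ) x
      rwa [Submodule.orthogonal_orthogonal] at this
    have h2 : T (x - T.kerᗮ.starProjection x) = 0 := h1
    rw [map_sub, sub_eq_zero] at h2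
    exact h2.symm
  have hinj : T₀.ker = ⊥ := by
    rw [LinearMap.ker_eq_bot']
    intro x hx
    have h1 : T (x : X) = 0 := congrArg Subtype.val hx
    have h2 : (x : X) ∈ T.ker := h1
    have h3 := (Submodule.mem_orthogonal _ _).1 x.2 _ h2
    exact Subtype.ext (inner_self_eq_zero.1 h3)
  have hsurj : T₀.range = ⊤ := by
    rw [LinearMap.range_eq_top]
    rintro ⟨_, x, rfl⟩
    exact ⟨T.kerᗮ.orthogonalProjectionOnto x, Subtype.ext (hdec x)⟩
  let e : T.kerᗮ ≃L[ℂ] T.range := ContinuousLinearEquiv.ofBijective T₀ hinj hsurj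
  let S : Y →L[ℂ] X := T.kerᗮ.subtypeL ∘L e.symm.toContinuousLinearMap ∘L
    T.range.orthogonalProjectionOnto
  have hTS : T ∘L S = T.range.starProjection := by
    ext y
    have h1 : e (e.symm (T.range.orthogonalProjectionOnto y)) = T.range.orthogonalProjectionOnto y :=
      e.apply_symm_apply _
    exact congrArg Subtype.val h1
  have hST : S ∘L T = T.kerᗮ.starProjection := by
    ext x
    have h1 : T.range.orthogonalProjectionOnto (T x) = e (T.kerᗮ.orthogonalProjectionOnto x) := by
      apply Subtype.ext
      refine (Submodule.starProjection_eq_self_iff.2 (LinearMap.mem_range_self _ x)).trans ?_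
      exact (hdec x).symm
    have h2 : e.symm (T.range.orthogonalProjectionOnto (T x)) =
        T.kerᗮ.orthogonalProjectionOnto x := by
      rw [h1]
      exact e.symm_apply_apply _
    exact congrArg Subtype.val h2
  refine ⟨S, ?_, ?_, ?_, ?_⟩
  · rw [hST]
    ext x
    exact hdec x
  · ext y
    have h1 : (S ∘L T) (S y) = S y := by
      rw [hST]
      exact Submodule.starProjection_eq_self_iff.2 (Subtype.prop _)
    exact h1
  · rw [hTS]
    exact isSelfAdjoint_starProjection _
  · rw [hST]
    exact isSelfAdjoint_starProjection _

namespace Intertwiner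

variable {B : Type v} [NonUnitalCStarAlgebra B] {X Y Z : HilbertRep.{v, u} B}

/-- The identity operator. -/
def one (X : HilbertRep.{v, u} B) : Intertwiner X X where
  op := ContinuousLinearMap.id ℂ X
  op_rep _ _ := rfl

/-- Composition `S ∘ T`. -/
def comp (S : Intertwiner Y Z) (T : Intertwiner X Y) : Intertwiner X Z where
  op := S.op ∘L T.op
  op_rep b x := by simp [T.op_rep, S.op_rep]

/-- The Hilbert space adjoint. -/
def adjoint (T : Intertwiner X Y) : Intertwiner Y X where
  op := T.op.adjoint
  op_rep b y := by
    apply ext_inner_right ℂ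
    intro x
    rw [ContinuousLinearMap.adjoint_inner_left, Y.inner_rep_left, X.inner_rep_left,
      ContinuousLinearMap.adjoint_inner_left, T.op_rep]

theorem moorePenrose_op_rep (T : Intertwiner X Y) (b : B) (y : Y) :
    moorePenrose T.op (Y.rep b y) = X.rep b (moorePenrose T.op y) := by
  by_cases h : ∃ S, IsMoorePenrose T.op S
  swap
  · simp [moorePenrose, dif_neg h]
  have hS : IsMoorePenrose T.op (moorePenrose T.op) := by
    rw [moorePenrose, dif_pos h]
    exact h.choose_spec
  generalize moorePenrose T.op = S at hS
  have hT : ∀ b x, T.op (X.rep b x) = Y.rep b (T.op x) := T.op_rep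
  have e1 : ∀ x, T.op (S (T.op x)) = T.op x := DFunLike.congr_fun hS.mul_inv_mul
  have e2 : ∀ y, S (T.op (S y)) = S y := DFunLike.congr_fun hS.inv_mul_inv
  have e3 : ∀ y z, ⟪T.op (S y), z⟫_ℂ = ⟪y, T.op (S z)⟫_ℂ := by
    intro y z
    have := hS.mul_inv_selfAdjoint
    exact this.isSymmetric y z
  have e4 : ∀ y z, ⟪S (T.op y), z⟫_ℂ = ⟪y, S (T.op z)⟫_ℂ := by
    intro y z
    exact hS.inv_mul_selfAdjoint.isSymmetric y z
  have p1 : ∀ b y, T.op (S (Y.rep b (T.op (S y)))) = Y.rep b (T.op (S y)) := by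
    intro b y
    rw [← hT, e1]
  have p2 : ∀ b y, T.op (S (Y.rep b y)) = Y.rep b (T.op (S y)) := by
    intro b y
    apply ext_inner_right ℂ
    intro z
    rw [e3, Y.inner_rep_left, ← p1, ← e3, ← Y.inner_rep_left, ← e3, p1]
  have q1 : ∀ b x, S (T.op (X.rep b (S (T.op x)))) = S (T.op (X.rep b x)) := by
    intro b x
    rw [hT, e1, ← hT]
  have q2 : ∀ b x, S (T.op (X.rep b x)) = X.rep b (S (T.op x)) := by
    intro b x
    apply ext_inner_right ℂ
    intro z
    rw [← q1, e4, X.inner_rep_left, e4, q1]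
    rw [X.inner_rep_left (b := b) (y := z), e4]
  rw [← e2, p2, ← hT, q2, e2]

/-- The Moore-Penrose inverse. -/
def mp (T : Intertwiner X Y) : Intertwiner Y X where
  op := moorePenrose T.op
  op_rep := T.moorePenrose_op_rep

end Intertwiner

namespace CStarCorrespondence

variable {B : Type v} {E : Type u} [NonUnitalCStarAlgebra B] [PartialOrder B]
  [StarOrderedRing B] [NormedAddCommGroup E] [NormedSpace ℂ E]
  (C : CStarCorrespondence B E)

/-- The closed subspace `E ⊗ M` of `E ⊗ X`, for a subspace `M` of `X`. -/
def tensorSub {X : HilbertRep.{v, u} B} (M : Submodule ℂ X) : Submodule ℂ (C.tensor X) :=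
  (Submodule.span ℂ {z : C.tensor X | ∃ ξ : E, ∃ x ∈ M, z = C.tmul X ξ x}).topologicalClosure

/-- The space `E^{⊗ n} ⊗ X = E ⊗ (E ⊗ (⋯ ⊗ (E ⊗ X)))`, with `E^{⊗ 0} ⊗ X = X`. -/
def pow : ℕ → HilbertRep.{v, u} B → HilbertRep.{v, u} B
  | 0, X => X
  | n + 1, X => pow n (C.tensor X)

/-- The operator `I_{E^{⊗ n}} ⊗ T`. -/
def mapPow : (n : ℕ) → {X Y : HilbertRep.{v, u} B} → Intertwiner X Y →
    Intertwiner (C.pow n X) (C.pow n Y)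
  | 0, _, _, T => T
  | n + 1, _, _, T => mapPow n (C.map T)

/-- The closed subspace `E^{⊗ n} ⊗ M`. -/
def powSub : (n : ℕ) → {X : HilbertRep.{v, u} B} → Submodule ℂ X → Submodule ℂ (C.pow n X)
  | 0, _, M => M
  | n + 1, _, M => powSub n (C.tensorSub M)

variable {C} {X : HilbertRep.{v, u} B}

/-- `T_n = T (I_E ⊗ T) ⋯ (I_{E^{⊗ n-1}} ⊗ T) : E^{⊗ n} ⊗ X → X` for `T : E ⊗ X → X`. -/
def iter (T : Intertwiner (C.tensor X) X) : (n : ℕ) → Intertwiner (C.pow n X) X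
  | 0 => Intertwiner.one X
  | n + 1 => (iter T n).comp (C.mapPow n T)

/-- `S^{(n)} = (I_{E^{⊗ n-1}} ⊗ S) ⋯ (I_E ⊗ S) S : X → E^{⊗ n} ⊗ X` for `S : X → E ⊗ X`. -/
def coiter (S : Intertwiner X (C.tensor X)) : (n : ℕ) → Intertwiner X (C.pow n X)
  | 0 => Intertwiner.one X
  | n + 1 => (C.mapPow n S).comp (coiter S n)

/-- The generalized range `R^∞(T) = ⋂_{n ≥ 0} R(T_n)`. -/
def genRange (T : Intertwiner (C.tensor X) X) : Submodule ℂ X :=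
  ⨅ n : ℕ, (iter T n).op.range

/-- `[M]_T = ⋁_{n ≥ 0} T_n (E^{⊗ n} ⊗ M)`, the closed linear span. -/
def genSpan (T : Intertwiner (C.tensor X) X) (M : Submodule ℂ X) : Submodule ℂ X :=
  (⨆ n : ℕ, (C.powSub n M).map (iter T n).op.toLinearMap).topologicalClosure

/-- The Cauchy dual `T' = T (T* T)^†`. -/
def cauchyDual (T : Intertwiner (C.tensor X) X) : Intertwiner (C.tensor X) X :=
  T.comp (T.adjoint.comp T).mp

/-- Regularity: `N(T) ⊆ E ⊗ R^∞(T)` and `R(T)` is closed. -/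
def IsRegular (T : Intertwiner (C.tensor X) X) : Prop :=
  T.op.ker ≤ C.tensorSub (genRange T) ∧ IsClosed (T.op.range : Set X)

/-- Bi-regularity: `T` is regular and `N(I_{E^{⊗ n}} ⊗ T^†) ⊆ R(T^{†(n)})` for all `n`. -/
def IsBiregular (T : Intertwiner (C.tensor X) X) : Prop :=
  IsRegular T ∧ ∀ n : ℕ, (C.mapPow n T.mp).op.ker ≤ (coiter T.mp n).op.range

end CStarCorrespondence
/-! ### Completely bounded covariant representations -/

namespace CStarCorrespondence

variable {B : Type v} {E : Type u} [NonUnitalCStarAlgebra B] [PartialOrder B]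
  [StarOrderedRing B] [NormedAddCommGroup E] [NormedSpace ℂ E]
  (C : CStarCorrespondence B E)

/-- The `M_n(B)`-valued inner square `⟨x, x⟩ = (∑_k ⟨x_{ki}, x_{kj}⟩)_{ij}` of `x ∈ M_n(E)`; the
norm of `M_n(E)` in the operator space structure of `E` is `‖⟨x, x⟩‖^{1/2}`. -/
def matGram {n : ℕ} (x : Matrix (Fin n) (Fin n) E) : CStarMatrix (Fin n) (Fin n) B :=
  CStarMatrix.ofMatrix fun i j => ∑ k, C.inn (x k i) (x k j)

/-- Complete boundedness of `V : E → B(H)`: the amplifications `M_n(E) → M_n(B(H)) = B(H^n)`,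
`x ↦ (V(x_{ij}))`, are bounded uniformly in `n`. -/
def IsCompletelyBounded {H : Type u} [NormedAddCommGroup H] [InnerProductSpace ℂ H]
    (V : E →ₗ[ℂ] (H →L[ℂ] H)) : Prop :=
  ∃ K : ℝ, ∀ (n : ℕ) (x : Matrix (Fin n) (Fin n) E) (h : Fin n → H),
    ∑ i, ‖∑ j, V (x i j) (h j)‖ ^ 2 ≤ K ^ 2 * ‖C.matGram x‖ * ∑ j, ‖h j‖ ^ 2

theorem IsCompletelyBounded.row {H : Type u} [NormedAddCommGroup H] [InnerProductSpace ℂ H]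
    {V : E →ₗ[ℂ] (H →L[ℂ] H)} {K : ℝ}
    (hK : ∀ (n : ℕ) (x : Matrix (Fin n) (Fin n) E) (h : Fin n → H),
      ∑ i, ‖∑ j, V (x i j) (h j)‖ ^ 2 ≤ K ^ 2 * ‖C.matGram x‖ * ∑ j, ‖h j‖ ^ 2)
    {n : ℕ} (ξ : Fin n → E) (h : Fin n → H) :
    ‖∑ j, V (ξ j) (h j)‖ ^ 2 ≤ K ^ 2 * ‖C.gram ξ‖ * ∑ j, ‖h j‖ ^ 2 := by
  rcases n with _ | n
  · simp
  · have h1 := hK (n + 1) (fun i j => if i = 0 then ξ j else 0) h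
    have h2 : C.matGram (fun i j => if i = 0 then ξ j else 0 : Matrix (Fin (n + 1)) (Fin (n + 1)) E)
        = C.gram ξ := by
      ext i j
      change ∑ k : Fin (n + 1), C.inn (if k = 0 then ξ i else 0) (if k = 0 then ξ j else 0) = _
      rw [Finset.sum_eq_single (0 : Fin (n + 1))]
      rotate_left
      · intro k _ hk
        simp [hk, C.inn_zero_left]
      · simp
      simp [gram_apply]
    rw [h2] at h1
    refine le_trans ?_ h1
    refine le_trans ?_ (Finset.single_le_sum (fun i _ => sq_nonneg _) (Finset.mem_univ 0))
    simp

theorem exists_cutoff (ε : ℝ) (hε : 0 < ε) :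
    ∃ f : ℝ → ℝ, Continuous f ∧ f 0 = 0 ∧ (∀ t, 0 ≤ t → ‖f t * t * f t‖ ≤ 1) ∧
      ∀ t, 0 ≤ t → ‖t - t * (f t * √t) - (f t * √t) * t + (f t * √t) * t * (f t * √t)‖ ≤ ε := by
  refine ⟨fun t => √t / (|t| + ε), ?_, by simp, fun t ht0 => ?_, fun t ht0 => ?_⟩
  · refine Continuous.div (by fun_prop) (by fun_prop) fun t => ?_
    positivity
  · have h2 : √t / (|t| + ε) * t * (√t / (|t| + ε)) = (t / (t + ε)) ^ 2 := by
      rw [abs_of_nonneg ht0]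
      have : √t * √t = t := Real.mul_self_sqrt ht0
      calc √t / (t + ε) * t * (√t / (t + ε)) = (√t * √t) * t / ((t + ε) * (t + ε)) := by
            rw [div_mul_eq_mul_div, div_mul_div_comm]
            congr 1
            ring
        _ = _ := by rw [this, div_pow, sq, sq]
    simp only [h2]
    rw [Real.norm_of_nonneg (by positivity)]
    apply pow_le_one₀ (by positivity)
    rw [div_le_one (by positivity)]
    linarith
  · have hu : 0 < t + ε := by linarith
    have hpt : √t / (|t| + ε) * √t = t / (t + ε) := by
      rw [abs_of_nonneg ht0, div_mul_eq_mul_div, Real.mul_self_sqrt ht0]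
    have h2 : t - t * (t / (t + ε)) - t / (t + ε) * t + t / (t + ε) * t * (t / (t + ε)) =
        t * ε ^ 2 / (t + ε) ^ 2 := by
      field_simp
      ring
    simp only [hpt, h2]
    rw [Real.norm_of_nonneg (by positivity), div_le_iff₀ (by positivity)]
    nlinarith [mul_nonneg ht0 hε.le, mul_nonneg (mul_nonneg ht0 ht0) hε.le, pow_pos hε 3,
      mul_nonneg ht0 (sq_nonneg ε)]

theorem exists_factor {D : Type*} [NonUnitalCStarAlgebra D] [PartialOrder D] [StarOrderedRing D]
    (m : D) (hm : 0 ≤ m) (ε : ℝ) (hε : 0 < ε) :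
    ∃ c s : D, star s * s = m ∧ ‖star c * m * c‖ ≤ 1 ∧
      ‖m - m * (c * s) - star (c * s) * m + star (c * s) * m * (c * s)‖ ≤ ε := by
  have hsa : IsSelfAdjoint m := .of_nonneg hm
  obtain ⟨f, hfc, hf0, hb1, hb2⟩ := exists_cutoff ε hε
  obtain ⟨p, hpf⟩ : ∃ p : ℝ → ℝ, p = fun t => f t * √t := ⟨_, rfl⟩
  have hpc : Continuous p := by rw [hpf]; fun_prop
  have hp0 : p 0 = 0 := by rw [hpf]; simp
  have hpt : ∀ t, f t * √t = p t := fun t => by rw [hpf]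
  simp only [hpt] at hb2
  have hcs : cfcₙ f m * cfcₙ Real.sqrt m = cfcₙ p m := by
    rw [← cfcₙ_mul (R := ℝ) f Real.sqrt m (by fun_prop) hf0 (by fun_prop) Real.sqrt_zero, hpf]
  clear hpt hpf
  have hnn : ∀ t ∈ quasispectrum ℝ m, 0 ≤ t := fun t ht => quasispectrum_nonneg_of_nonneg m hm t ht
  have hid : cfcₙ (fun t : ℝ => t) m = m := cfcₙ_id' ℝ m hsa
  have hc : star (cfcₙ f m) = cfcₙ f m := (cfcₙ_predicate f m : IsSelfAdjoint _).star_eq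
  have hs : star (cfcₙ Real.sqrt m) = cfcₙ Real.sqrt m :=
    (cfcₙ_predicate Real.sqrt m : IsSelfAdjoint _).star_eq
  have hpS : star (cfcₙ p m) = cfcₙ p m := (cfcₙ_predicate p m : IsSelfAdjoint _).star_eq
  have m1 : cfcₙ (fun t : ℝ => f t * t) m = cfcₙ f m * m := by
    rw [cfcₙ_mul (R := ℝ) f (fun t => t) m, hid]
  have m2 : cfcₙ (fun t : ℝ => p t * t) m = cfcₙ p m * m := by
    rw [cfcₙ_mul (R := ℝ) p (fun t => t) m, hid]
  have m3 : cfcₙ (fun t : ℝ => t * p t) m = m * cfcₙ p m := by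
    rw [cfcₙ_mul (R := ℝ) (fun t => t) p m, hid]
  refine ⟨cfcₙ f m, cfcₙ Real.sqrt m, ?_, ?_, ?_⟩
  · rw [hs, ← cfcₙ_mul (R := ℝ) Real.sqrt Real.sqrt m]
    conv_rhs => rw [← hid]
    exact cfcₙ_congr fun t ht => Real.mul_self_sqrt (hnn t ht)
  · have h1 : star (cfcₙ f m) * m * cfcₙ f m = cfcₙ (fun t : ℝ => f t * t * f t) m := by
      rw [hc, cfcₙ_mul (R := ℝ) (fun t => f t * t) f m (by fun_prop) (by simp) (by fun_prop) hf0,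
        m1]
    rw [h1]
    exact norm_cfcₙ_le fun t ht => hb1 t (hnn t ht)
  · have h1 : m - m * cfcₙ p m - cfcₙ p m * m + cfcₙ p m * m * cfcₙ p m =
        cfcₙ (fun t : ℝ => t - t * p t - p t * t + p t * t * p t) m := by
      rw [cfcₙ_add (R := ℝ) (fun t => t - t * p t - p t * t) (fun t => p t * t * p t) m
          (by fun_prop) (by simp) (by fun_prop) (by simp),
        cfcₙ_sub (R := ℝ) (fun t => t - t * p t) (fun t => p t * t) m
          (by fun_prop) (by simp) (by fun_prop) (by simp),
        cfcₙ_sub (R := ℝ) (fun t => t) (fun t => t * p t) m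
          (by fun_prop) rfl (by fun_prop) (by simp),
        cfcₙ_mul (R := ℝ) (fun t => p t * t) p m (by fun_prop) (by simp) (by fun_prop) hp0,
        m2, m3, hid]
    rw [hcs, hpS, h1]
    exact norm_cfcₙ_le fun t ht => hb2 t (hnn t ht)

end CStarCorrespondence

/-- A completely bounded covariant (c.b.c.) representation `(σ, V)` of the correspondence `E` on
`H`. -/
structure CBCRep {B : Type v} {E : Type u} [NonUnitalCStarAlgebra B] [PartialOrder B]
    [StarOrderedRing B] [NormedAddCommGroup E] [NormedSpace ℂ E] (C : CStarCorrespondence B E)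
    (H : Type u) [NormedAddCommGroup H] [InnerProductSpace ℂ H] [CompleteSpace H] where
  σ : B →⋆ₙₐ[ℂ] (H →L[ℂ] H)
  σ_nondegenerate :
    (Submodule.span ℂ {x : H | ∃ b y, x = σ b y}).topologicalClosure = ⊤
  V : E →ₗ[ℂ] (H →L[ℂ] H)
  /-- together with the next law: `V(b ξ c) = σ(b) V(ξ) σ(c)` -/
  covariant_left : ∀ b ξ, V (C.lact b ξ) = σ b * V ξ
  covariant_right : ∀ ξ c, V (C.ract ξ c) = V ξ * σ c
  completelyBounded : C.IsCompletelyBounded V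

namespace CBCRep

variable {B : Type v} {E : Type u} [NonUnitalCStarAlgebra B] [PartialOrder B]
  [StarOrderedRing B] [NormedAddCommGroup E] [NormedSpace ℂ E] {C : CStarCorrespondence B E}
  {H : Type u} [NormedAddCommGroup H] [InnerProductSpace ℂ H] [CompleteSpace H]

/-- `H` with the representation `σ`. -/
def toRep (R : CBCRep C H) : HilbertRep.{v, u} B where
  carrier := H
  rep := R.σ

/-- The map `ξ ⊗ h ↦ V(ξ) h` on `E ⊗[ℂ] H`. -/
def preTildeAux (R : CBCRep C H) : E ⊗[ℂ] H →ₗ[ℂ] H :=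
  TensorProduct.lift (LinearMap.mk₂ ℂ (fun (ξ : E) (x : H) => R.V ξ x)
    (by intro ξ η x; simp) (by intro c ξ x; simp) (by intro ξ x y; simp) (by intro c ξ x; simp))

/-- The map `ξ ⊗ h ↦ V(ξ) h` on algebraic tensors. -/
def preTilde (R : CBCRep C H) : C.PreTensor R.toRep →ₗ[ℂ] H := R.preTildeAux

theorem preTilde_ptmul (R : CBCRep C H) (ξ : E) (x : H) :
    R.preTilde (C.ptmul R.toRep ξ x) = R.V ξ x := rfl

theorem V_sum_ract (R : CBCRep C H) {n : ℕ} (ξ : Fin n → E) (a : Fin n → B) (x : H) :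
    R.V (∑ k, C.ract (ξ k) (a k)) x = ∑ k, R.V (ξ k) (R.σ (a k) x) := by
  rw [map_sum, sum_apply]
  exact Finset.sum_congr rfl fun k _ => by rw [R.covariant_right]; rfl

theorem gram_sub (C : CStarCorrespondence B E) {n : ℕ} (ξ : Fin n → E)
    (p : CStarMatrix (Fin n) (Fin n) B) :
    C.gram (fun i => ξ i - ∑ k, C.ract (ξ k) (p k i)) =
      C.gram ξ - C.gram ξ * p - star p * C.gram ξ + star p * C.gram ξ * p := by
  have hsub : ∀ a b c : E, C.inn a (b - c) = C.inn a b - C.inn a c := by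
    intro a b c
    rw [eq_sub_iff_add_eq, ← C.inn_add_right, sub_add_cancel]
  have hsub' : ∀ a b c : E, C.inn (b - c) a = C.inn b a - C.inn c a := by
    intro a b c
    rw [eq_sub_iff_add_eq, ← C.inn_add_left, sub_add_cancel]
  rw [C.star_mul_gram_mul]
  ext i j
  have h1 : (C.gram ξ * p) i j = C.inn (ξ i) (∑ k, C.ract (ξ k) (p k j)) := by
    simp only [CStarMatrix.mul_apply, C.gram_apply, C.inn_sum_right, C.inn_ract]
  have h2 : (star p * C.gram ξ) i j = C.inn (∑ k, C.ract (ξ k) (p k i)) (ξ j) := by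
    simp only [CStarMatrix.mul_apply, C.gram_apply, C.inn_sum_left, C.inn_ract_left,
      CStarMatrix.star_apply]
  rw [CStarMatrix.add_apply, CStarMatrix.sub_apply, CStarMatrix.sub_apply, h1, h2, C.gram_apply,
    C.gram_apply, C.gram_apply, hsub, hsub', hsub']
  abel

theorem norm_sum_le (R : CBCRep C H) {K : ℝ}
    (hK : ∀ (n : ℕ) (x : Matrix (Fin n) (Fin n) E) (h : Fin n → H),
      ∑ i, ‖∑ j, R.V (x i j) (h j)‖ ^ 2 ≤ K ^ 2 * ‖C.matGram x‖ * ∑ j, ‖h j‖ ^ 2)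
    {n : ℕ} (ξ : Fin n → E) (x : Fin n → H) :
    ‖∑ i, R.V (ξ i) (x i)‖ ≤ |K| * ‖∑ i, C.ptmul R.toRep (ξ i) (x i)‖ := by
  set N := ‖∑ i, C.ptmul R.toRep (ξ i) (x i)‖ with hN
  set M := √(∑ j, ‖x j‖ ^ 2) with hM
  have hM2 : M ^ 2 = ∑ j, ‖x j‖ ^ 2 := Real.sq_sqrt (Finset.sum_nonneg fun _ _ => sq_nonneg _)
  have key : ∀ δ : ℝ, 0 < δ → ‖∑ i, R.V (ξ i) (x i)‖ ≤ |K| * N + δ * (|K| * M) := by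
    intro δ hδ
    obtain ⟨c, s, hs, hc, hp⟩ := CStarCorrespondence.exists_factor (C.gram ξ) (C.gram_nonneg ξ)
      (δ ^ 2) (by positivity)
    rw [← gram_sub] at hp
    rw [C.star_mul_gram_mul] at hc
    have b1 := CStarCorrespondence.IsCompletelyBounded.row C hK
      (fun i => ξ i - ∑ k, C.ract (ξ k) ((c * s) k i)) x
    have b2 := CStarCorrespondence.IsCompletelyBounded.row C hK
      (fun i => ∑ k, C.ract (ξ k) (c k i)) (fun j => ∑ i, R.σ (s j i) (x i))
    have hNs : N ^ 2 = ∑ j, ‖∑ i, R.σ (s j i) (x i)‖ ^ 2 := by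
      have := (C.ofReal_norm_sq_pre _ _).trans (C.preForm_self_sum R.toRep ξ x (fun k i => s k i)
        (by
          intro i j
          rw [← C.gram_apply, ← hs]
          simp [CStarMatrix.mul_apply, CStarMatrix.star_apply]))
      exact Complex.ofReal_injective this
    have e1 : ∑ j, R.V (∑ k, C.ract (ξ k) (c k j)) (∑ i, R.σ (s j i) (x i)) =
        ∑ i, R.V (∑ k, C.ract (ξ k) ((c * s) k i)) (x i) := by
      have f1 : ∀ j, R.V (∑ k, C.ract (ξ k) (c k j)) (∑ i, R.σ (s j i) (x i)) =
          ∑ i, ∑ k, R.V (ξ k) (R.σ (c k j * s j i) (x i)) := by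
        intro j
        rw [map_sum (R.V (∑ k, C.ract (ξ k) (c k j)))]
        refine Finset.sum_congr rfl fun i _ => ?_
        rw [R.V_sum_ract ξ (fun k => c k j)]
        exact Finset.sum_congr rfl fun k _ => by rw [map_mul]; rfl
      have f2 : ∀ i, R.V (∑ k, C.ract (ξ k) ((c * s) k i)) (x i) =
          ∑ j, ∑ k, R.V (ξ k) (R.σ (c k j * s j i) (x i)) := by
        intro i
        rw [R.V_sum_ract ξ (fun k => (c * s) k i), Finset.sum_comm]
        refine Finset.sum_congr rfl fun k _ => ?_
        rw [CStarMatrix.mul_apply, map_sum, sum_apply, map_sum]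
      rw [Finset.sum_congr rfl fun j _ => f1 j, Finset.sum_congr rfl fun i _ => f2 i]
      exact Finset.sum_comm
    have e2 : ∑ i, R.V (ξ i) (x i) =
        ∑ i, R.V (ξ i - ∑ k, C.ract (ξ k) ((c * s) k i)) (x i) +
        ∑ j, R.V (∑ k, C.ract (ξ k) (c k j)) (∑ i, R.σ (s j i) (x i)) := by
      rw [e1, ← Finset.sum_add_distrib]
      refine Finset.sum_congr rfl fun i _ => ?_
      rw [map_sub, sub_apply, sub_add_cancel]
    have c1 : ‖∑ i, R.V (ξ i - ∑ k, C.ract (ξ k) ((c * s) k i)) (x i)‖ ≤ δ * (|K| * M) := by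
      apply le_of_sq_le_sq _ (by positivity)
      refine b1.trans ?_
      rw [← hM2, mul_pow, mul_pow, sq_abs]
      calc _ ≤ K ^ 2 * δ ^ 2 * M ^ 2 := by gcongr
        _ = _ := by ring
    have c2 : ‖∑ j, R.V (∑ k, C.ract (ξ k) (c k j)) (∑ i, R.σ (s j i) (x i))‖ ≤ |K| * N := by
      apply le_of_sq_le_sq _ (by positivity)
      refine b2.trans ?_
      rw [← hNs, mul_pow, sq_abs]
      calc _ ≤ K ^ 2 * 1 * N ^ 2 := by gcongr
        _ = _ := by ring
    rw [e2]
    refine (norm_add_le _ _).trans ?_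
    linarith
  refine le_of_forall_pos_le_add fun η hη => ?_
  have hpos : 0 < |K| * M + 1 := by positivity
  refine (key (η / (|K| * M + 1)) (by positivity)).trans ?_
  have : η / (|K| * M + 1) * (|K| * M) ≤ η := by
    rw [div_mul_eq_mul_div, div_le_iff₀ hpos]
    nlinarith
  linarith

theorem exists_norm_preTilde_le (R : CBCRep C H) :
    ∃ K : ℝ, ∀ z, ‖R.preTilde z‖ ≤ K * ‖z‖ := by
  obtain ⟨K, hK⟩ := R.completelyBounded
  refine ⟨|K|, fun z => ?_⟩
  obtain ⟨S, rfl⟩ := C.exists_sum R.toRep z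
  have h := R.norm_sum_le hK (fun i => (S.equivFin.symm i).1.1) (fun i => (S.equivFin.symm i).1.2)
  rw [Equiv.sum_comp S.equivFin.symm (fun i : S => R.V i.1.1 i.1.2)] at h
  rw [Equiv.sum_comp S.equivFin.symm (fun i : S => C.ptmul R.toRep i.1.1 i.1.2)] at h
  rw [map_sum]
  exact h

/-- The extension of `ξ ⊗ h ↦ V(ξ) h` to the completion. -/
def tildeAux (R : CBCRep C H) : UniformSpace.Completion (C.PreTensor R.toRep) →L[ℂ] H :=
  (R.preTilde.mkContinuousOfExistsBound R.exists_norm_preTilde_le).fromCompletion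

/-- The bounded operator `Ṽ : E ⊗_σ H → H`, `Ṽ(ξ ⊗ h) = V(ξ) h`. -/
def tildeCLM (R : CBCRep C H) : C.tensor R.toRep →L[ℂ] R.toRep := R.tildeAux

theorem tildeCLM_tmul (R : CBCRep C H) (ξ : E) (x : H) :
    R.tildeCLM (C.tmul R.toRep ξ x) = R.V ξ x :=
  ContinuousLinearMap.fromCompletion_apply_coe (R.preTilde.mkContinuousOfExistsBound
    R.exists_norm_preTilde_le) _

/-- The bounded operator `Ṽ : E ⊗_σ H → H`, with `σ(b) Ṽ = Ṽ (φ(b) ⊗ I)`. -/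
def tilde (R : CBCRep C H) : Intertwiner (C.tensor R.toRep) R.toRep where
  op := R.tildeCLM
  op_rep b := DFunLike.congr_fun (F := C.tensor R.toRep →L[ℂ] R.toRep)
    (f := R.tildeCLM.comp ((C.tensor R.toRep).rep b)) (g := (R.toRep.rep b).comp R.tildeCLM)
    (C.tensor_ext R.toRep fun ξ x => by
      rw [ContinuousLinearMap.comp_apply, ContinuousLinearMap.comp_apply, C.rep_tmul]
      refine (R.tildeCLM_tmul _ _).trans ?_
      rw [R.covariant_left]
      exact congrArg (R.σ b) (R.tildeCLM_tmul ξ x).symm)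

theorem tilde_tmul (R : CBCRep C H) (ξ : E) (x : H) :
    R.tilde.op (C.tmul R.toRep ξ x) = R.V ξ x := R.tildeCLM_tmul ξ x

end CBCRep

namespace CStarCorrespondence

variable {B : Type v} {E : Type u} [NonUnitalCStarAlgebra B] [PartialOrder B]
  [StarOrderedRing B] [NormedAddCommGroup E] [NormedSpace ℂ E]
  {C : CStarCorrespondence B E} {X : HilbertRep.{v, u} B}

/-- The subspace `𝓔 = X ⊖ T(E ⊗ X) = R(T)^⊥`. -/
def wandering (T : Intertwiner (C.tensor X) X) : Submodule ℂ X := T.op.rangeᗮ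

/-- `R(T) = M₁ ⊕ M₂` (orthogonally) with `T(E ⊗ M₁) ⊆ M₁`, `T^†(M₁) ⊆ E ⊗ (M₁ ⊕ 𝓔)` and
`P_{M₂} T(E ⊗ M₂) = M₂`. -/
structure IsRangeSplitting (T : Intertwiner (C.tensor X) X) (M₁ M₂ : ClosedSubmodule ℂ X) :
    Prop where
  map_left : (C.tensorSub M₁.toSubmodule).map T.op.toLinearMap ≤ M₁.toSubmodule
  mp_left : M₁.toSubmodule.map T.mp.op.toLinearMap ≤
    C.tensorSub (M₁.toSubmodule ⊔ wandering T)
  proj_right : ((C.tensorSub M₂.toSubmodule).map T.op.toLinearMap).map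
    M₂.toSubmodule.starProjection.toLinearMap = M₂.toSubmodule
  orthogonal : M₁.toSubmodule ⟂ M₂.toSubmodule
  range_eq : T.op.range = M₁.toSubmodule ⊔ M₂.toSubmodule

end CStarCorrespondence

end

/-! ### Uniqueness of the Moore–Penrose inverse and closures of images. -/

noncomputable section

open scoped TensorProduct ComplexOrder InnerProductSpace

/-! Write `T` for `Ṽ`, `T†` for its Moore–Penrose inverse, `T'` for the Cauchy dual, `𝓔 = R(T)ᗮ` and
`W = [𝓔]_T`, the smallest closed `T`-invariant subspace containing `𝓔`. Everything rests on one
consequence of bi-regularity: `T† T` is the identity on `E ⊗ W` (`mp_op_of_mem`). Indeed `T†` kills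
`𝓔`, so `E^{⊗ n} ⊗ 𝓔` lies in the kernel of `I ⊗ T†` and hence in the range of `T^{†(n)}`; applying
`I ⊗ T` sends the range of `T^{†(n+1)}` into that of `T^{†(n)}`, and induction puts `E ⊗ W` in the
closure of `R(T†)` (`powSub_iterate_le`).

Since `T' = (T†)*` (`cauchyDual_eq`), it follows that `R^∞(T') = Wᗮ` (`genRange_cauchyDual`), which
is 1 ⇔ 2. If `W` is proper, then `Wᗮ` witnesses 3 and 4, `W` witnesses 5 and 6, and the pair `W ∩
R(T)`, `Wᗮ` witnesses 7. Conversely, a witness of 3 or 4 is orthogonal to `W` by induction along the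
generation of `W` (`wanderingSpan_le_orthogonal`), 6 implies 5, and a witness of 5 contains `W` by
minimality.

The implication 7 ⇒ 1 (`IsRangeSplitting.wanderingSpan_ne_top`) produces a non-zero reducing
subspace `F` of `M₂` whose complement is `T`-invariant and contains `𝓔`, so that `W ⊆ Fᗮ`.

A recurring difficulty is that the given subspaces need not be invariant under `B`, while `E ⊗ M`
and `E ⊗ N` are known to be orthogonal for `M ⟂ N` only if one of them is. Passing to the largest
reducing subspace inside (`redCore`) or the smallest one outside (`redHull`) repairs this: the hull
does not change `E ⊗ M`, because `ξ ⊗ σ(b)x = ξb ⊗ x`. -/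

/-- `TS` and `TS'` are self-adjoint projections with the same range `R(T)`, and `ST`, `S'T` are
self-adjoint projections with the same kernel `N(T)`; hence `S = STS = S'TS' = S'`. This identifies
the inverse picked by choice in `moorePenrose` with explicit formulas. -/
theorem IsMoorePenrose.eq {X Y : Type*} [NormedAddCommGroup X] [InnerProductSpace ℂ X]
    [CompleteSpace X] [NormedAddCommGroup Y] [InnerProductSpace ℂ Y] [CompleteSpace Y]
    {T : X →L[ℂ] Y} {S S' : Y →L[ℂ] X} (h : IsMoorePenrose T S) (h' : IsMoorePenrose T S') :
    S = S' := by
  have e1 : ∀ x, T (S (T x)) = T x := DFunLike.congr_fun h.mul_inv_mul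
  have e2 : ∀ y, S (T (S y)) = S y := DFunLike.congr_fun h.inv_mul_inv
  have e3 : ∀ y z, ⟪T (S y), z⟫_ℂ = ⟪y, T (S z)⟫_ℂ := h.mul_inv_selfAdjoint.isSymmetric
  have e4 : ∀ y z, ⟪S (T y), z⟫_ℂ = ⟪y, S (T z)⟫_ℂ := h.inv_mul_selfAdjoint.isSymmetric
  have f1 : ∀ x, T (S' (T x)) = T x := DFunLike.congr_fun h'.mul_inv_mul
  have f2 : ∀ y, S' (T (S' y)) = S' y := DFunLike.congr_fun h'.inv_mul_inv
  have f3 : ∀ y z, ⟪T (S' y), z⟫_ℂ = ⟪y, T (S' z)⟫_ℂ := h'.mul_inv_selfAdjoint.isSymmetric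
  have f4 : ∀ y z, ⟪S' (T y), z⟫_ℂ = ⟪y, S' (T z)⟫_ℂ := h'.inv_mul_selfAdjoint.isSymmetric
  have g1 : ∀ y, T (S y) = T (S' y) := by
    intro y
    refine ext_inner_right ℂ fun z => ?_
    rw [← f1 (S y), f3, e3, e1, ← f3]
  have g2 : ∀ x, S (T x) = S' (T x) := by
    intro x
    refine ext_inner_right ℂ fun z => ?_
    rw [← f1 x, e4, f4 x, e1, f1, f4]
  ext y
  rw [← e2, g1, g2, f2]

theorem Submodule.isClosed_comap {X Y : Type*} [NormedAddCommGroup X] [NormedSpace ℂ X]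
    [NormedAddCommGroup Y] [NormedSpace ℂ Y] (f : X →L[ℂ] Y) {N : Submodule ℂ Y}
    (hN : IsClosed (N : Set Y)) : IsClosed (N.comap f.toLinearMap : Set X) :=
  hN.preimage f.continuous

theorem Submodule.map_topologicalClosure_le {X Y : Type*} [NormedAddCommGroup X] [NormedSpace ℂ X]
    [NormedAddCommGroup Y] [NormedSpace ℂ Y] (f : X →L[ℂ] Y) (M : Submodule ℂ X) :
    M.topologicalClosure.map f.toLinearMap ≤ (M.map f.toLinearMap).topologicalClosure := by
  rw [Submodule.map_le_iff_le_comap]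
  exact Submodule.topologicalClosure_minimal _
    (Submodule.map_le_iff_le_comap.1 (Submodule.le_topologicalClosure _))
    (Submodule.isClosed_comap f (Submodule.isClosed_topologicalClosure _))

theorem Intertwiner.ext {B : Type v} [NonUnitalCStarAlgebra B] {X Y : HilbertRep.{v, u} B}
    {S T : Intertwiner X Y} (h : S.op = T.op) : S = T := by
  cases S; cases T; cases h; rfl

/-! ### Subspaces invariant under the action of `B`: reducing core and reducing hull. -/

/-- A subspace invariant under the representation of `B`. -/
def HilbertRep.IsReducing {B : Type v} [NonUnitalCStarAlgebra B] (X : HilbertRep.{v, u} B)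
    (M : Submodule ℂ X) : Prop :=
  ∀ b, ∀ x ∈ M, X.rep b x ∈ M

namespace HilbertRep.IsReducing

variable {B : Type v} [NonUnitalCStarAlgebra B] {X Y : HilbertRep.{v, u} B} {M N : Submodule ℂ X}

theorem orthogonal (hM : X.IsReducing M) : X.IsReducing Mᗮ := by
  intro b x hx
  rw [Submodule.mem_orthogonal] at hx ⊢
  intro y hy
  rw [← star_star b, ← X.inner_rep_left]
  exact hx _ (hM _ _ hy)

theorem inf (hM : X.IsReducing M) (hN : X.IsReducing N) : X.IsReducing (M ⊓ N) :=
  fun b x hx => ⟨hM b x hx.1, hN b x hx.2⟩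

theorem topologicalClosure (hM : X.IsReducing M) : X.IsReducing M.topologicalClosure := by
  intro b x hx
  have h : M.topologicalClosure.map (X.rep b).toLinearMap ≤ M.topologicalClosure :=
    (Submodule.map_topologicalClosure_le _ _).trans
      (Submodule.topologicalClosure_mono (Submodule.map_le_iff_le_comap.2 (hM b)))
  exact h ⟨x, hx, rfl⟩

theorem range (T : Intertwiner Y X) : X.IsReducing T.op.range := by
  rintro b _ ⟨y, rfl⟩
  exact ⟨Y.rep b y, T.op_rep b y⟩

end HilbertRep.IsReducing

namespace HilbertRep

variable {B : Type v} [NonUnitalCStarAlgebra B] (X : HilbertRep.{v, u} B)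

/-- The largest reducing subspace contained in `N`. -/
def redCore (N : Submodule ℂ X) : Submodule ℂ X :=
  -- `N` is a separate term because `B` may have no unit and the representation may be degenerate,
  -- so the translates alone do not control the vector itself.
  N ⊓ ⨅ b, N.comap (X.rep b).toLinearMap

theorem mem_redCore {N : Submodule ℂ X} {x : X} :
    x ∈ X.redCore N ↔ x ∈ N ∧ ∀ b, X.rep b x ∈ N := by
  simp [redCore]

theorem redCore_le (N : Submodule ℂ X) : X.redCore N ≤ N := inf_le_left

theorem redCore_isReducing (N : Submodule ℂ X) : X.IsReducing (X.redCore N) := by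
  intro b x hx
  rw [mem_redCore] at hx ⊢
  refine ⟨hx.2 b, fun c => ?_⟩
  have := hx.2 (c * b)
  rwa [map_mul] at this

theorem isClosed_redCore {N : Submodule ℂ X} (hN : IsClosed (N : Set X)) :
    IsClosed (X.redCore N : Set X) := by
  rw [redCore, Submodule.coe_inf, Submodule.coe_iInf]
  exact hN.inter (isClosed_iInter fun b => Submodule.isClosed_comap (X.rep b) hN)

theorem le_redCore {M N : Submodule ℂ X} (hM : X.IsReducing M) (h : M ≤ N) : M ≤ X.redCore N :=
  fun x hx => X.mem_redCore.2 ⟨h hx, fun b => h (hM b x hx)⟩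

/-- The smallest reducing subspace containing `N`. -/
def redHull (N : Submodule ℂ X) : Submodule ℂ X :=
  N ⊔ ⨆ b, N.map (X.rep b).toLinearMap

theorem le_redHull (N : Submodule ℂ X) : N ≤ X.redHull N := le_sup_left

theorem redHull_le {M N : Submodule ℂ X} (hM : X.IsReducing M) (h : N ≤ M) : X.redHull N ≤ M :=
  sup_le h (iSup_le fun b => Submodule.map_le_iff_le_comap.2 fun x hx => hM b x (h hx))

theorem redHull_isReducing (N : Submodule ℂ X) : X.IsReducing (X.redHull N) := by
  intro b
  have hb : ∀ c, N.map (X.rep c).toLinearMap ≤ X.redHull N :=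
    fun c => le_sup_of_le_right (le_iSup (fun b => N.map (X.rep b).toLinearMap) c)
  have h : X.redHull N ≤ (X.redHull N).comap (X.rep b).toLinearMap := by
    refine sup_le (fun x hx => hb b ⟨x, hx, rfl⟩) (iSup_le fun c => ?_)
    rintro _ ⟨x, hx, rfl⟩
    refine hb (b * c) ⟨x, hx, ?_⟩
    rw [map_mul]
    rfl
  exact h

end HilbertRep

namespace CStarCorrespondence

variable {B : Type v} {E : Type u} [NonUnitalCStarAlgebra B] [PartialOrder B]
  [StarOrderedRing B] [NormedAddCommGroup E] [NormedSpace ℂ E]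
  (C : CStarCorrespondence B E) {X Y Z : HilbertRep.{v, u} B}

/-! ### The subspaces `E ⊗ M` -/

variable {C} in
theorem ext_inner_tmul {z w : C.tensor X}
    (h : ∀ ξ x, ⟪z, C.tmul X ξ x⟫_ℂ = ⟪w, C.tmul X ξ x⟫_ℂ) : z = w := by
  have h1 : innerSL ℂ z = innerSL ℂ w := C.tensor_ext X h
  exact ext_inner_right ℂ fun v => DFunLike.congr_fun h1 v

variable {C} in
theorem ext_inner_tmul' {z w : C.tensor X}
    (h : ∀ ξ x, ⟪C.tmul X ξ x, z⟫_ℂ = ⟪C.tmul X ξ x, w⟫_ℂ) : z = w :=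
  ext_inner_tmul fun ξ x => by rw [← inner_conj_symm, h, inner_conj_symm]

/-- The tensor product is built over `ℂ`; balancing over `B` comes for free, as both sides have the
same inner products with all elementary tensors. -/
theorem tmul_ract (ξ : E) (b : B) (x : X) :
    C.tmul X (C.ract ξ b) x = C.tmul X ξ (X.rep b x) :=
  ext_inner_tmul fun η y => by
    rw [inner_tmul, inner_tmul, C.inn_ract_left, map_mul, X.inner_rep_left]
    rfl

/-- The map `x ↦ ξ ⊗ x` as a linear map. -/
def tmulLM (X : HilbertRep.{v, u} B) (ξ : E) : X →ₗ[ℂ] C.tensor X where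
  toFun := C.tmul X ξ
  map_add' x y := ext_inner_tmul' fun η z => by simp [inner_tmul]
  map_smul' c x := ext_inner_tmul' fun η z => by simp [inner_tmul]

theorem norm_tmul_le (ξ : E) (x : X) :
    ‖C.tmul X ξ x‖ ≤ √‖X.rep (C.inn ξ ξ)‖ * ‖x‖ := by
  apply le_of_sq_le_sq _ (by positivity)
  rw [mul_pow, Real.sq_sqrt (norm_nonneg _)]
  calc ‖C.tmul X ξ x‖ ^ 2 = ‖⟪C.tmul X ξ x, C.tmul X ξ x⟫_ℂ‖ := by
        rw [inner_self_eq_norm_sq_to_K]; simp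
    _ = ‖⟪x, X.rep (C.inn ξ ξ) x⟫_ℂ‖ := by rw [inner_tmul]
    _ ≤ ‖x‖ * ‖X.rep (C.inn ξ ξ) x‖ := norm_inner_le_norm _ _
    _ ≤ ‖x‖ * (‖X.rep (C.inn ξ ξ)‖ * ‖x‖) := by
        gcongr; exact (X.rep (C.inn ξ ξ)).le_opNorm x
    _ = _ := by ring

/-- The bounded operator `x ↦ ξ ⊗ x`. -/
def tmulCLM (X : HilbertRep.{v, u} B) (ξ : E) : X →L[ℂ] C.tensor X :=
  (C.tmulLM X ξ).mkContinuous _ (C.norm_tmul_le ξ)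

theorem tmulCLM_apply (ξ : E) (x : X) : C.tmulCLM X ξ x = C.tmul X ξ x := rfl

theorem isClosed_tensorSub (M : Submodule ℂ X) : IsClosed (C.tensorSub M : Set (C.tensor X)) :=
  Submodule.isClosed_topologicalClosure _

variable {C} in
theorem tmul_mem_tensorSub {M : Submodule ℂ X} (ξ : E) {x : X} (hx : x ∈ M) :
    C.tmul X ξ x ∈ C.tensorSub M :=
  Submodule.le_topologicalClosure _ (Submodule.subset_span ⟨ξ, x, hx, rfl⟩)

variable {C} in
theorem tensorSub_le {M : Submodule ℂ X} {N : Submodule ℂ (C.tensor X)}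
    (hN : IsClosed (N : Set (C.tensor X))) (h : ∀ ξ, ∀ x ∈ M, C.tmul X ξ x ∈ N) :
    C.tensorSub M ≤ N := by
  refine Submodule.topologicalClosure_minimal _ (Submodule.span_le.2 ?_) hN
  rintro _ ⟨ξ, x, hx, rfl⟩
  exact h ξ x hx

theorem tensorSub_mono {M N : Submodule ℂ X} (h : M ≤ N) : C.tensorSub M ≤ C.tensorSub N :=
  tensorSub_le (C.isClosed_tensorSub N) fun ξ _ hx => tmul_mem_tensorSub ξ (h hx)

theorem tensorSub_topologicalClosure (M : Submodule ℂ X) :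
    C.tensorSub M.topologicalClosure = C.tensorSub M := by
  refine le_antisymm (tensorSub_le (C.isClosed_tensorSub M) fun ξ => ?_)
    (C.tensorSub_mono (Submodule.le_topologicalClosure M))
  exact Submodule.topologicalClosure_minimal (t := (C.tensorSub M).comap (C.tmulCLM X ξ).toLinearMap)
    M (fun x hx => tmul_mem_tensorSub ξ hx)
    (Submodule.isClosed_comap _ (C.isClosed_tensorSub M))

/-- A translate `σ(b)x` can be absorbed into the left factor, by `tmul_ract`. So `E ⊗ M` only sees
the reducing hull of `M`. -/
theorem tensorSub_redHull_le (M : Submodule ℂ X) : C.tensorSub (X.redHull M) ≤ C.tensorSub M := by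
  refine tensorSub_le (C.isClosed_tensorSub M) fun ξ => ?_
  have h : X.redHull M ≤ (C.tensorSub M).comap (C.tmulCLM X ξ).toLinearMap := by
    refine sup_le (fun x hx => tmul_mem_tensorSub ξ hx) (iSup_le fun b => ?_)
    rintro _ ⟨x, hx, rfl⟩
    change C.tmul X ξ (X.rep b x) ∈ C.tensorSub M
    rw [← C.tmul_ract]
    exact tmul_mem_tensorSub _ hx
  exact h

theorem tensorSub_iSup_le {ι : Sort*} {M : ι → Submodule ℂ X} {N : Submodule ℂ (C.tensor X)}
    (hN : IsClosed (N : Set (C.tensor X))) (h : ∀ i, C.tensorSub (M i) ≤ N) :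
    C.tensorSub (⨆ i, M i) ≤ N := by
  refine tensorSub_le hN fun ξ => ?_
  have h1 : ⨆ i, M i ≤ N.comap (C.tmulCLM X ξ).toLinearMap :=
    iSup_le fun i x hx => h i (tmul_mem_tensorSub ξ hx)
  exact h1

theorem tensorSub_top : C.tensorSub (⊤ : Submodule ℂ X) = ⊤ := by
  have : CompleteSpace (C.tensorSub (⊤ : Submodule ℂ X)) :=
    (C.isClosed_tensorSub _).completeSpace_coe
  rw [← Submodule.orthogonal_eq_bot_iff, Submodule.eq_bot_iff]
  intro z hz
  refine ext_inner_tmul' fun ξ x => ?_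
  rw [inner_zero_right]
  exact (Submodule.mem_orthogonal _ _).1 hz _ (tmul_mem_tensorSub ξ trivial)

theorem tensorSub_isReducing (M : Submodule ℂ X) : (C.tensor X).IsReducing (C.tensorSub M) := by
  intro b
  have h : C.tensorSub M ≤ (C.tensorSub M).comap ((C.tensor X).rep b).toLinearMap := by
    refine tensorSub_le (Submodule.isClosed_comap _ (C.isClosed_tensorSub M)) fun ξ x hx => ?_
    change (C.tensor X).rep b (C.tmul X ξ x) ∈ C.tensorSub M
    rw [rep_tmul]
    exact tmul_mem_tensorSub _ hx
  exact h

/-- The inner product of `ξ ⊗ x` and `η ⊗ y` is `⟪x, σ(⟨ξ, η⟩)y⟫`; orthogonality of `x` and `y` is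
not enough, but it is once `σ(⟨ξ, η⟩)y` stays in `N`. -/
theorem tensorSub_isOrtho {M N : Submodule ℂ X} (hN : X.IsReducing N) (h : M ⟂ N) :
    C.tensorSub M ⟂ C.tensorSub N := by
  refine tensorSub_le (Submodule.isClosed_orthogonal _) fun ξ x hx => ?_
  have h1 : C.tensorSub N ≤ (ℂ ∙ C.tmul X ξ x)ᗮ := by
    refine tensorSub_le (Submodule.isClosed_orthogonal _) fun η y hy => ?_
    rw [Submodule.mem_orthogonal_singleton_iff_inner_right, inner_tmul]
    exact h.inner_eq hx (hN _ _ hy)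
  rw [Submodule.mem_orthogonal']
  exact fun w hw => (Submodule.mem_orthogonal_singleton_iff_inner_right.1 (h1 hw))

/-- The projection `P` onto `E ⊗ F` fixes `E ⊗ F` and kills `E ⊗ K`, so `I - P` sends the generators
of `E ⊗ (K + F)` into the closed space `E ⊗ K`. The decomposition `z = (z - Pz) + Pz` thus survives
the closure in the definition of `E ⊗ (K + F)`. -/
theorem exists_add_of_mem_tensorSub_sup {K F : Submodule ℂ X} (hF : X.IsReducing F) (h : K ⟂ F)
    {z : C.tensor X} (hz : z ∈ C.tensorSub (K ⊔ F)) :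
    ∃ a ∈ C.tensorSub K, ∃ b ∈ C.tensorSub F, z = a + b := by
  have : CompleteSpace (C.tensorSub F) := (C.isClosed_tensorSub _).completeSpace_coe
  set P := (C.tensorSub F).starProjection with hP
  have h1 : C.tensorSub (K ⊔ F) ≤ (C.tensorSub K).comap
      (ContinuousLinearMap.id ℂ (C.tensor X) - P).toLinearMap := by
    refine tensorSub_le (Submodule.isClosed_comap _ (C.isClosed_tensorSub K)) fun ξ => ?_
    have h2 : K ⊔ F ≤ ((C.tensorSub K).comap
      (ContinuousLinearMap.id ℂ (C.tensor X) - P).toLinearMap).comap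
        (C.tmulCLM X ξ).toLinearMap := by
      refine sup_le (fun x hx => ?_) fun x hx => ?_
      · change C.tmul X ξ x - P (C.tmul X ξ x) ∈ C.tensorSub K
        have h3 := tmul_mem_tensorSub (C := C) ξ hx
        rw [hP, (Submodule.starProjection_apply_eq_zero_iff _).2 (C.tensorSub_isOrtho hF h h3), sub_zero]
        exact h3
      · change C.tmul X ξ x - P (C.tmul X ξ x) ∈ C.tensorSub K
        rw [hP, Submodule.starProjection_eq_self_iff.2 (tmul_mem_tensorSub ξ hx), sub_self]
        exact zero_mem _
    exact h2
  exact ⟨z - P z, h1 hz, P z, Submodule.starProjection_apply_mem _ _, by abel⟩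

theorem tensorSub_orthogonal {M : Submodule ℂ X} (hMc : IsClosed (M : Set X))
    (hM : X.IsReducing M) : (C.tensorSub M)ᗮ = C.tensorSub Mᗮ := by
  have : CompleteSpace M := hMc.completeSpace_coe
  have ho : C.tensorSub Mᗮ ≤ (C.tensorSub M)ᗮ :=
    C.tensorSub_isOrtho hM (Submodule.isOrtho_orthogonal_left M)
  refine le_antisymm (fun z hz => ?_) ho
  have hz' : z ∈ C.tensorSub (M ⊔ Mᗮ) := by
    rw [Submodule.sup_orthogonal_of_hasOrthogonalProjection, tensorSub_top]
    trivial
  obtain ⟨a, ha, b, hb, rfl⟩ :=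
    C.exists_add_of_mem_tensorSub_sup hM.orthogonal (Submodule.isOrtho_orthogonal_right M) hz'
  have h1 : a ∈ (C.tensorSub M)ᗮ := by simpa using Submodule.sub_mem _ hz (ho hb)
  rw [Submodule.inf_orthogonal_eq_bot (C.tensorSub M) |>.le ⟨ha, h1⟩, zero_add]
  exact hb

end CStarCorrespondence

namespace CStarCorrespondence

variable {B : Type v} {E : Type u} [NonUnitalCStarAlgebra B] [PartialOrder B]
  [StarOrderedRing B] [NormedAddCommGroup E] [NormedSpace ℂ E]
  (C : CStarCorrespondence B E) {X Y Z : HilbertRep.{v, u} B}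

/-! ### The operators `I_{E^{⊗ n}} ⊗ S` -/

theorem map_comp (S : Intertwiner Y Z) (T : Intertwiner X Y) :
    C.map (S.comp T) = (C.map S).comp (C.map T) := by
  refine Intertwiner.ext (C.tensor_ext X fun ξ x => ?_)
  change _ = (C.map S).op ((C.map T).op (C.tmul X ξ x))
  rw [map_tmul, map_tmul, map_tmul]
  rfl

theorem map_adjoint (S : Intertwiner X Y) : C.map S.adjoint = (C.map S).adjoint := by
  refine Intertwiner.ext (C.tensor_ext Y fun ξ y => ext_inner_tmul fun η x => ?_)
  change _ = ⟪(C.map S).op.adjoint (C.tmul Y ξ y), _⟫_ℂ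
  rw [map_tmul, ContinuousLinearMap.adjoint_inner_left, map_tmul, inner_tmul, inner_tmul,
    ← S.op_rep]
  exact ContinuousLinearMap.adjoint_inner_left _ _ _

theorem map_mem_tensorSub (S : Intertwiner X Y) {M : Submodule ℂ X} {N : Submodule ℂ Y}
    (h : ∀ x ∈ M, S.op x ∈ N) : ∀ z ∈ C.tensorSub M, (C.map S).op z ∈ C.tensorSub N := by
  have h1 : C.tensorSub M ≤ (C.tensorSub N).comap (C.map S).op.toLinearMap := by
    refine tensorSub_le (Submodule.isClosed_comap _ (C.isClosed_tensorSub N)) fun ξ x hx => ?_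
    change (C.map S).op (C.tmul X ξ x) ∈ C.tensorSub N
    rw [map_tmul]
    exact tmul_mem_tensorSub ξ (h x hx)
  exact h1

theorem map_eq_self (S : Intertwiner X X) {M : Submodule ℂ X} (h : ∀ x ∈ M, S.op x = x) :
    ∀ z ∈ C.tensorSub M, (C.map S).op z = z := by
  have h1 : C.tensorSub M ≤ (C.map S).op.toLinearMap.eqLocus LinearMap.id := by
    refine tensorSub_le (isClosed_eq (C.map S).op.continuous continuous_id) fun ξ x hx => ?_
    change (C.map S).op (C.tmul X ξ x) = C.tmul X ξ x
    rw [map_tmul, h x hx]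
  exact h1

theorem map_tensorSub_topologicalClosure (S : Intertwiner X Y) (M : Submodule ℂ X) :
    ((C.tensorSub M).map (C.map S).op.toLinearMap).topologicalClosure =
      C.tensorSub (M.map S.op.toLinearMap).topologicalClosure := by
  rw [tensorSub_topologicalClosure]
  refine le_antisymm (Submodule.topologicalClosure_minimal _ ?_ (C.isClosed_tensorSub _))
    (tensorSub_le (Submodule.isClosed_topologicalClosure _) ?_)
  · rw [Submodule.map_le_iff_le_comap]
    exact C.map_mem_tensorSub S fun x hx => ⟨x, hx, rfl⟩
  · rintro ξ _ ⟨x, hx, rfl⟩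
    exact Submodule.le_topologicalClosure _
      ⟨C.tmul X ξ x, tmul_mem_tensorSub ξ hx, C.map_tmul S ξ x⟩

theorem mapPow_comp (n : ℕ) (S : Intertwiner Y Z) (T : Intertwiner X Y) :
    C.mapPow n (S.comp T) = (C.mapPow n S).comp (C.mapPow n T) := by
  induction n generalizing X Y Z with
  | zero => rfl
  | succ n ih =>
    change C.mapPow n (C.map (S.comp T)) = _
    rw [map_comp, ih]
    rfl

theorem mapPow_adjoint (n : ℕ) (S : Intertwiner X Y) :
    C.mapPow n S.adjoint = (C.mapPow n S).adjoint := by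
  induction n generalizing X Y with
  | zero => rfl
  | succ n ih =>
    change C.mapPow n (C.map S.adjoint) = _
    rw [map_adjoint, ih]
    rfl

theorem mapPow_mem_powSub (n : ℕ) (S : Intertwiner X Y) {M : Submodule ℂ X} {N : Submodule ℂ Y}
    (h : ∀ x ∈ M, S.op x ∈ N) : ∀ z ∈ C.powSub n M, (C.mapPow n S).op z ∈ C.powSub n N := by
  induction n generalizing X Y with
  | zero => exact h
  | succ n ih => exact ih (C.map S) (C.map_mem_tensorSub S h)

theorem mapPow_eq_self (n : ℕ) (S : Intertwiner X X) {M : Submodule ℂ X}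
    (h : ∀ x ∈ M, S.op x = x) : ∀ z ∈ C.powSub n M, (C.mapPow n S).op z = z := by
  induction n generalizing X with
  | zero => exact h
  | succ n ih => exact ih (C.map S) (C.map_eq_self S h)

theorem tensorSub_bot : C.tensorSub (⊥ : Submodule ℂ X) = ⊥ := by
  refine le_bot_iff.1 (tensorSub_le (N := ⊥) ?_ ?_)
  · exact isClosed_singleton
  · intro ξ x hx
    rw [Submodule.mem_bot] at hx
    rw [hx, ← tmulCLM_apply, map_zero]
    exact zero_mem _

theorem powSub_bot (n : ℕ) : C.powSub n (⊥ : Submodule ℂ X) = ⊥ := by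
  induction n generalizing X with
  | zero => rfl
  | succ n ih =>
    change C.powSub n (C.tensorSub ⊥) = ⊥
    rw [tensorSub_bot, ih]

theorem mapPow_eq_zero (n : ℕ) (S : Intertwiner X Y) {M : Submodule ℂ X}
    (h : ∀ x ∈ M, S.op x = 0) : ∀ z ∈ C.powSub n M, (C.mapPow n S).op z = 0 := by
  intro z hz
  -- Vanishing on `M` is read as mapping `M` into the zero subspace, whose tensor powers are zero.
  have := C.mapPow_mem_powSub n S (N := ⊥) (fun x hx => by simp [h x hx]) z hz
  rwa [powSub_bot] at this

theorem powSub_mono (n : ℕ) {M N : Submodule ℂ X} (h : M ≤ N) : C.powSub n M ≤ C.powSub n N := by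
  induction n generalizing X with
  | zero => exact h
  | succ n ih => exact ih (C.tensorSub_mono h)

/-- The outer closure on the right is needed only for `n = 0`, where `powSub` returns its argument
and closes nothing by itself. -/
theorem map_powSub_topologicalClosure (n : ℕ) (S : Intertwiner X Y) (M : Submodule ℂ X) :
    ((C.powSub n M).map (C.mapPow n S).op.toLinearMap).topologicalClosure =
      (C.powSub n (M.map S.op.toLinearMap).topologicalClosure).topologicalClosure := by
  induction n generalizing X Y with
  | zero =>
    exact ((Submodule.isClosed_topologicalClosure _).submodule_topologicalClosure_eq).symm
  | succ n ih =>
    refine (ih (C.map S) (C.tensorSub M)).trans ?_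
    rw [map_tensorSub_topologicalClosure]
    rfl

variable {C}

/-! ### The invariant subspace generated by a subspace -/

/-- The closure of `T(E ⊗ M)`. -/
def imageClosure (T : Intertwiner (C.tensor X) X) (M : Submodule ℂ X) : Submodule ℂ X :=
  ((C.tensorSub M).map T.op.toLinearMap).topologicalClosure

theorem topologicalClosure_map_eq {V W : Type*} [NormedAddCommGroup V] [NormedSpace ℂ V]
    [NormedAddCommGroup W] [NormedSpace ℂ W] (f : V →L[ℂ] W) (M : Submodule ℂ V) :
    (M.topologicalClosure.map f.toLinearMap).topologicalClosure =
      (M.map f.toLinearMap).topologicalClosure :=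
  le_antisymm (Submodule.topologicalClosure_minimal _ (Submodule.map_topologicalClosure_le f M)
      (Submodule.isClosed_topologicalClosure _))
    (Submodule.topologicalClosure_mono (Submodule.map_mono (Submodule.le_topologicalClosure M)))

/-- Up to closure, `T_n(E^{⊗ n} ⊗ M)` is the `n`-fold iterate of `M ↦ T(E ⊗ M)`. This trades the
iterated tensor spaces for subspaces of `X`, where the invariance of `[M]_T` is an index shift. -/
theorem map_iter_topologicalClosure (T : Intertwiner (C.tensor X) X) (n : ℕ) (M : Submodule ℂ X)
    (hM : IsClosed (M : Set X)) :
    ((C.powSub n M).map (iter T n).op.toLinearMap).topologicalClosure =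
      (imageClosure T)^[n] M := by
  induction n generalizing M with
  | zero =>
    refine Eq.trans ?_ hM.submodule_topologicalClosure_eq
    exact congrArg _ (Submodule.map_id M)
  | succ n ih =>
    have h1 : (C.powSub (n + 1) M).map (iter T (n + 1)).op.toLinearMap =
        ((C.powSub n (C.tensorSub M)).map (C.mapPow n T).op.toLinearMap).map
          (iter T n).op.toLinearMap := Submodule.map_comp _ _ _
    rw [h1, ← topologicalClosure_map_eq, map_powSub_topologicalClosure, topologicalClosure_map_eq,
      Function.iterate_succ_apply, ← ih]
    · rfl
    · exact Submodule.isClosed_topologicalClosure _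

variable {T : Intertwiner (C.tensor X) X} {M : Submodule ℂ X}

theorem iterate_imageClosure_le_genSpan (hM : IsClosed (M : Set X)) (n : ℕ) :
    (imageClosure T)^[n] M ≤ genSpan T M := by
  rw [← map_iter_topologicalClosure T n M hM]
  exact Submodule.topologicalClosure_mono
    (le_iSup (fun n => (C.powSub n M).map (iter T n).op.toLinearMap) n)

theorem genSpan_eq (hM : IsClosed (M : Set X)) :
    genSpan T M = (⨆ n : ℕ, (imageClosure T)^[n] M).topologicalClosure := by
  refine le_antisymm (Submodule.topologicalClosure_mono (iSup_mono fun n => ?_))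
    (Submodule.topologicalClosure_minimal _ (iSup_le fun n => iterate_imageClosure_le_genSpan hM n)
      (Submodule.isClosed_topologicalClosure _))
  rw [← map_iter_topologicalClosure T n M hM]
  exact Submodule.le_topologicalClosure _

theorem isClosed_genSpan : IsClosed (genSpan T M : Set X) :=
  Submodule.isClosed_topologicalClosure _

theorem le_genSpan : M ≤ genSpan T M :=
  fun x hx => Submodule.le_topologicalClosure _
    (Submodule.mem_iSup_of_mem 0 ⟨x, hx, rfl⟩)

theorem map_tensorSub_genSpan_le (hM : IsClosed (M : Set X)) :
    ∀ z ∈ C.tensorSub (genSpan T M), T.op z ∈ genSpan T M := by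
  have h1 : C.tensorSub (genSpan T M) ≤ (genSpan T M).comap T.op.toLinearMap := by
    have hc := Submodule.isClosed_comap T.op (isClosed_genSpan (T := T) (M := M))
    rw [genSpan_eq hM, tensorSub_topologicalClosure, ← genSpan_eq hM]
    refine C.tensorSub_iSup_le hc fun n => ?_
    rw [← Submodule.map_le_iff_le_comap]
    -- One more application of `T` moves the `n`-th iterate to the `(n + 1)`-st, again a piece of
    -- `[M]_T`.
    refine le_trans ?_ (iterate_imageClosure_le_genSpan hM (n + 1))
    rw [Function.iterate_succ_apply']
    exact Submodule.le_topologicalClosure _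
  exact h1

theorem iter_mem {N : Submodule ℂ X} (h : ∀ z ∈ C.tensorSub N, T.op z ∈ N) (n : ℕ) :
    ∀ z ∈ C.powSub n N, (iter T n).op z ∈ N := by
  induction n with
  | zero => exact fun z hz => hz
  | succ n ih => exact fun z hz => ih _ (C.mapPow_mem_powSub n T h z hz)

theorem genSpan_le {N : Submodule ℂ X} (hN : IsClosed (N : Set X)) (hMN : M ≤ N)
    (h : ∀ z ∈ C.tensorSub N, T.op z ∈ N) : genSpan T M ≤ N := by
  refine Submodule.topologicalClosure_minimal _ (iSup_le fun n => ?_) hN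
  rintro _ ⟨z, hz, rfl⟩
  exact iter_mem h n z (C.powSub_mono n hMN hz)

/-- A closed subspace contains `[M]_T` as soon as it contains `M` and `T(E ⊗ K)` for the largest
reducing subspace `K` contained in it. -/
theorem genSpan_le_of_redCore (hMr : X.IsReducing M) {N : Submodule ℂ X}
    (hN : IsClosed (N : Set X)) (hMN : M ≤ N)
    (h : ∀ z ∈ C.tensorSub (X.redCore N), T.op z ∈ N) : genSpan T M ≤ X.redCore N := by
  refine genSpan_le (X.isClosed_redCore hN) (X.le_redCore hMr hMN) fun z hz => ?_
  -- Since `T` commutes with the actions and `E ⊗ K` is always reducing, the translates of `T z` are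
  -- again of the form `T z'` with `z'` in `E ⊗ K`.
  refine X.mem_redCore.2 ⟨h z hz, fun b => ?_⟩
  rw [← T.op_rep]
  exact h _ (C.tensorSub_isReducing _ b z hz)

theorem genSpan_isReducing (hMc : IsClosed (M : Set X)) (hMr : X.IsReducing M) :
    X.IsReducing (genSpan T M) := by
  have h : genSpan T M ≤ X.redCore (genSpan T M) :=
    genSpan_le_of_redCore hMr isClosed_genSpan le_genSpan fun z hz =>
      map_tensorSub_genSpan_le hMc z (C.tensorSub_mono (X.redCore_le _) hz)
  exact fun b x hx => (X.mem_redCore.1 (h hx)).2 b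

/-! ### Moore-Penrose inverse and Cauchy dual -/

/-- This is `(T*T)† = T†(T†)*`: multiplied by `T*T` on either side, the candidate collapses to the
projection `T†T`, because `(T†)*T* = TT†` and `T*(T†)* = T†T`. -/
theorem isMoorePenrose_adjoint_comp {V W : Type*} [NormedAddCommGroup V] [InnerProductSpace ℂ V]
    [CompleteSpace V] [NormedAddCommGroup W] [InnerProductSpace ℂ W] [CompleteSpace W]
    {T : V →L[ℂ] W} {S : W →L[ℂ] V} (h : IsMoorePenrose T S) :
    IsMoorePenrose (T.adjoint ∘L T) (S ∘L S.adjoint) := by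
  have a1 : ∀ x, T (S (T x)) = T x := DFunLike.congr_fun h.mul_inv_mul
  have a2 : ∀ y, S (T (S y)) = S y := DFunLike.congr_fun h.inv_mul_inv
  have e3 : ∀ y, S.adjoint (T.adjoint y) = T (S y) := by
    have := h.mul_inv_selfAdjoint.adjoint_eq
    rw [ContinuousLinearMap.adjoint_comp] at this
    exact DFunLike.congr_fun this
  have e4 : ∀ y, T.adjoint (S.adjoint y) = S (T y) := by
    have := h.inv_mul_selfAdjoint.adjoint_eq
    rw [ContinuousLinearMap.adjoint_comp] at this
    exact DFunLike.congr_fun this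
  have e5 : ∀ y, T.adjoint (T (S y)) = T.adjoint y := by
    intro y
    refine ext_inner_right ℂ fun x => ?_
    rw [ContinuousLinearMap.adjoint_inner_left, ← e3, ContinuousLinearMap.adjoint_inner_left,
      ContinuousLinearMap.adjoint_inner_left, a1, ← ContinuousLinearMap.adjoint_inner_left]
  have f1 : (T.adjoint ∘L T) ∘L (S ∘L S.adjoint) = S ∘L T := by
    ext x
    exact (e5 _).trans (e4 x)
  have f2 : (S ∘L S.adjoint) ∘L (T.adjoint ∘L T) = S ∘L T := by
    ext x
    change S (S.adjoint (T.adjoint (T x))) = S (T x)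
    rw [e3, a1]
  refine ⟨?_, ?_, ?_, ?_⟩
  · rw [f2]
    ext x
    change T.adjoint (T (S (T x))) = T.adjoint (T x)
    rw [a1]
  · rw [← ContinuousLinearMap.comp_assoc, f2]
    ext x
    exact a2 _
  · rw [f1]; exact h.inv_mul_selfAdjoint
  · rw [f2]; exact h.inv_mul_selfAdjoint

end CStarCorrespondence

namespace CStarCorrespondence

variable {B : Type v} {E : Type u} [NonUnitalCStarAlgebra B] [PartialOrder B]
  [StarOrderedRing B] [NormedAddCommGroup E] [NormedSpace ℂ E]
  {C : CStarCorrespondence B E} {X : HilbertRep.{v, u} B} {T : Intertwiner (C.tensor X) X}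

/-- With `(T*T)† = T†(T†)*`, the Cauchy dual is `TT†(T†)*`. As `TT†` is self-adjoint, this is
`(T†TT†)* = (T†)*`. -/
theorem cauchyDual_eq (hT : IsClosed (T.op.range : Set X)) : cauchyDual T = T.mp.adjoint := by
  have h : IsMoorePenrose T.op T.mp.op := moorePenrose_spec T.op hT
  have h1 := isMoorePenrose_adjoint_comp h
  have h2 : moorePenrose (T.op.adjoint ∘L T.op) = T.mp.op ∘L T.mp.op.adjoint := by
    have h3 : ∃ S, IsMoorePenrose (T.op.adjoint ∘L T.op) S := ⟨_, h1⟩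
    rw [moorePenrose, dif_pos h3]
    exact h3.choose_spec.eq h1
  have e3 : T.mp.op.adjoint ∘L T.op.adjoint = T.op ∘L T.mp.op := by
    have := h.mul_inv_selfAdjoint.adjoint_eq
    rwa [ContinuousLinearMap.adjoint_comp] at this
  have e : T.op ∘L T.mp.op ∘L T.mp.op.adjoint = T.mp.op.adjoint := by
    rw [← ContinuousLinearMap.comp_assoc, ← e3, ContinuousLinearMap.comp_assoc,
      ← ContinuousLinearMap.adjoint_comp, ← ContinuousLinearMap.adjoint_comp,
      ContinuousLinearMap.comp_assoc, h.inv_mul_inv]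
  refine Intertwiner.ext (Eq.trans ?_ e)
  exact congrArg (T.op ∘L ·) h2

theorem isClosed_wandering : IsClosed (wandering T : Set X) := Submodule.isClosed_orthogonal _

theorem wandering_isReducing : X.IsReducing (wandering T) :=
  (HilbertRep.IsReducing.range T).orthogonal

theorem op_mp_op (hT : IsClosed (T.op.range : Set X)) (z : C.tensor X) :
    T.op (T.mp.op (T.op z)) = T.op z :=
  DFunLike.congr_fun (moorePenrose_spec T.op hT).mul_inv_mul z

theorem mp_op_mp (hT : IsClosed (T.op.range : Set X)) (x : X) :
    T.mp.op (T.op (T.mp.op x)) = T.mp.op x :=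
  DFunLike.congr_fun (moorePenrose_spec T.op hT).inv_mul_inv x

theorem inner_op_mp (hT : IsClosed (T.op.range : Set X)) (x y : X) :
    ⟪T.op (T.mp.op x), y⟫_ℂ = ⟪x, T.op (T.mp.op y)⟫_ℂ :=
  (moorePenrose_spec T.op hT).mul_inv_selfAdjoint.isSymmetric x y

theorem inner_mp_op (hT : IsClosed (T.op.range : Set X)) (z w : C.tensor X) :
    ⟪T.mp.op (T.op z), w⟫_ℂ = ⟪z, T.mp.op (T.op w)⟫_ℂ :=
  (moorePenrose_spec T.op hT).inv_mul_selfAdjoint.isSymmetric z w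

theorem mem_range_of_mem_orthogonal (hT : IsClosed (T.op.range : Set X)) {x : X}
    (hx : x ∈ (wandering T)ᗮ) : x ∈ T.op.range := by
  have : CompleteSpace T.op.range := hT.completeSpace_coe
  rwa [wandering, Submodule.orthogonal_orthogonal] at hx

theorem op_mp_of_mem_range (hT : IsClosed (T.op.range : Set X)) {x : X}
    (hx : x ∈ T.op.range) : T.op (T.mp.op x) = x := by
  obtain ⟨z, rfl⟩ := hx
  exact op_mp_op hT z

theorem mp_of_mem_wandering (hT : IsClosed (T.op.range : Set X)) {x : X}
    (hx : x ∈ wandering T) : T.mp.op x = 0 := by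
  have h1 : T.op (T.mp.op x) = 0 := by
    rw [← inner_self_eq_zero (𝕜 := ℂ), inner_op_mp hT, op_mp_op hT]
    exact (Submodule.mem_orthogonal' _ _).1 hx _ ⟨_, rfl⟩
  rw [← mp_op_mp hT, h1, map_zero]

theorem sub_op_mp_mem_wandering (hT : IsClosed (T.op.range : Set X)) (x : X) :
    x - T.op (T.mp.op x) ∈ wandering T := by
  refine (Submodule.mem_orthogonal' _ _).2 ?_
  rintro _ ⟨z, rfl⟩
  change ⟪_, T.op z⟫_ℂ = 0
  rw [inner_sub_left, inner_op_mp hT, op_mp_op hT, sub_self]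

/-! ### Bi-regularity and the subspace generated by `𝓔`. -/

/-- `I_{E^{⊗ n}} ⊗ T` maps the range of `T^{†(n+1)}` into that of `T^{†(n)}`. -/
theorem mapPow_mem_range_coiter (hT : IsBiregular T) (n : ℕ) (x : X) :
    (C.mapPow n T).op ((coiter T.mp (n + 1)).op x) ∈ (coiter T.mp n).op.range := by
  set y := (coiter T.mp n).op x with hy
  change (C.mapPow n T).op ((C.mapPow n T.mp).op y) ∈ _
  have h1 : (C.mapPow n T.mp).op ((C.mapPow n T).op ((C.mapPow n T.mp).op y)) =
      (C.mapPow n T.mp).op y := by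
    have h2 : T.mp.comp (T.comp T.mp) = T.mp := Intertwiner.ext
      (ContinuousLinearMap.ext fun x => mp_op_mp hT.1.2 x)
    have h3 := congrArg Intertwiner.op (congrArg (C.mapPow n) h2)
    rw [mapPow_comp, mapPow_comp] at h3
    exact DFunLike.congr_fun h3 y
  -- The defect `y - (I ⊗ TT†)y` is killed by `I ⊗ T†`, so bi-regularity places it in the range of
  -- `T^{†(n)}`; so does `y` itself lie there, hence so does their difference.
  have h2 : y - (C.mapPow n T).op ((C.mapPow n T.mp).op y) ∈ (coiter T.mp n).op.range := by
    refine hT.2 n ?_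
    change (C.mapPow n T.mp).op _ = 0
    rw [map_sub, h1, sub_self]
  have h3 : y ∈ (coiter T.mp n).op.range := ⟨x, rfl⟩
  simpa using Submodule.sub_mem _ h3 h2

/-- Induction on `k` for all `n` at once: each use of `T` lowers the tensor power by one, so the
claim for `(k + 1, n)` comes from `(k, n + 1)`. Only `n = 1` is used in the end. -/
theorem powSub_iterate_le (hT : IsBiregular T) (k n : ℕ) :
    C.powSub n ((imageClosure T)^[k] (wandering T)) ≤
      ((coiter T.mp n).op.range).topologicalClosure := by
  induction k generalizing n with
  | zero =>
    refine le_trans (fun z hz => ?_) (Submodule.le_topologicalClosure _)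
    -- `T†` vanishes on `𝓔`, so `E^{⊗ n} ⊗ 𝓔` lies in the kernel to which bi-regularity applies.
    exact hT.2 n (C.mapPow_eq_zero n T.mp (fun x hx => mp_of_mem_wandering hT.1.2 hx) z hz)
  | succ k ih =>
    rw [Function.iterate_succ_apply']
    refine (Submodule.le_topologicalClosure _).trans ?_
    rw [imageClosure, ← map_powSub_topologicalClosure]
    refine Submodule.topologicalClosure_minimal _ ?_ (Submodule.isClosed_topologicalClosure _)
    refine (Submodule.map_mono (ih (n + 1))).trans
      ((Submodule.map_topologicalClosure_le _ _).trans (Submodule.topologicalClosure_mono ?_))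
    rintro _ ⟨_, ⟨x, rfl⟩, rfl⟩
    exact mapPow_mem_range_coiter hT n x

variable (T) in
/-- The subspace `[𝓔]_T` generated by the wandering subspace `𝓔`. -/
abbrev wanderingSpan : Submodule ℂ X := genSpan T (wandering T)

theorem wanderingSpan_isReducing : X.IsReducing (wanderingSpan T) :=
  genSpan_isReducing isClosed_wandering wandering_isReducing

/-- For bi-regular `T`, the operator `T^† T` is the identity on `E ⊗ [𝓔]_T`. -/
theorem mp_op_of_mem (hT : IsBiregular T) {z : C.tensor X}
    (hz : z ∈ C.tensorSub (wanderingSpan T)) : T.mp.op (T.op z) = z := by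
  have hc : IsClosed ((T.mp.op ∘L T.op).toLinearMap.eqLocus LinearMap.id : Set (C.tensor X)) :=
    isClosed_eq (T.mp.op ∘L T.op).continuous continuous_id
  have h1 : C.tensorSub (wanderingSpan T) ≤
      (T.mp.op ∘L T.op).toLinearMap.eqLocus LinearMap.id := by
    rw [wanderingSpan, genSpan_eq isClosed_wandering, tensorSub_topologicalClosure]
    refine C.tensorSub_iSup_le hc fun n => ?_
    -- For tensor power one the range in question is `R(T†)`, where `T†T` is the identity; the
    -- equality locus is closed.
    refine (powSub_iterate_le hT n 1).trans (Submodule.topologicalClosure_minimal _ ?_ hc)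
    rintro _ ⟨x, rfl⟩
    exact mp_op_mp hT.1.2 x
  exact h1 hz

theorem op_mem_wanderingSpan {z : C.tensor X} (hz : z ∈ C.tensorSub (wanderingSpan T)) :
    T.op z ∈ wanderingSpan T :=
  map_tensorSub_genSpan_le isClosed_wandering z hz

theorem orthogonal_wanderingSpan_le_range (hT : IsClosed (T.op.range : Set X)) :
    (wanderingSpan T)ᗮ ≤ T.op.range :=
  fun _ hx => mem_range_of_mem_orthogonal hT (Submodule.orthogonal_le le_genSpan hx)

/-- Dual form of the invariance of `W`. It needs `(E ⊗ W)ᗮ = E ⊗ Wᗮ`, which holds because `W` is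
closed and reducing. -/
theorem adjoint_mem_tensorSub {x : X} (hx : x ∈ (wanderingSpan T)ᗮ) :
    T.adjoint.op x ∈ C.tensorSub (wanderingSpan T)ᗮ := by
  rw [← C.tensorSub_orthogonal isClosed_genSpan wanderingSpan_isReducing,
    Submodule.mem_orthogonal']
  intro z hz
  refine (ContinuousLinearMap.adjoint_inner_left _ _ _).trans ?_
  exact (Submodule.mem_orthogonal' _ _).1 hx _ (op_mem_wanderingSpan hz)

theorem mp_mem_tensorSub (hT : IsBiregular T) :
    ∀ x ∈ wanderingSpan T, T.mp.op x ∈ C.tensorSub (wanderingSpan T) := by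
  -- The vectors of `W` with the desired property form a closed subspace containing `𝓔`, where `T†`
  -- vanishes. It is `T`-invariant because `T†Tz = z` on `E ⊗ W`, so minimality makes it all of `W`.
  set N := wanderingSpan T ⊓ (C.tensorSub (wanderingSpan T)).comap T.mp.op.toLinearMap with hN
  have h : wanderingSpan T ≤ N := by
    refine genSpan_le (IsClosed.inter isClosed_genSpan
      (Submodule.isClosed_comap _ (C.isClosed_tensorSub _))) (fun x hx => ⟨le_genSpan hx, ?_⟩)
      fun z hz => ?_
    · change T.mp.op x ∈ C.tensorSub (wanderingSpan T)
      rw [mp_of_mem_wandering hT.1.2 hx]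
      exact zero_mem _
    · have hz' := C.tensorSub_mono (inf_le_left : N ≤ _) hz
      refine ⟨op_mem_wanderingSpan hz', ?_⟩
      change T.mp.op (T.op z) ∈ C.tensorSub (wanderingSpan T)
      rwa [mp_op_of_mem hT hz']
  exact fun x hx => (h hx).2

/-! ### The generalized range of the Cauchy dual -/

theorem mp_adjoint_adjoint (hT : IsClosed (T.op.range : Set X)) (x : X) :
    T.mp.adjoint.op (T.adjoint.op x) = T.op (T.mp.op x) := by
  have := (moorePenrose_spec T.op hT).mul_inv_selfAdjoint.adjoint_eq
  rw [ContinuousLinearMap.adjoint_comp] at this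
  exact DFunLike.congr_fun this x

/-- On `Wᗮ ⊆ R(T)` the product `(T†)*T* = TT†` is the identity, and `T*` sends `Wᗮ` into `E ⊗ Wᗮ`.
So `T*` can be applied any number of times to find preimages under the iterates of `(T†)*`. -/
theorem mem_map_iter_powSub (hT : IsClosed (T.op.range : Set X)) (n : ℕ) :
    (wanderingSpan T)ᗮ ≤
      (C.powSub n (wanderingSpan T)ᗮ).map (iter T.mp.adjoint n).op.toLinearMap := by
  induction n with
  | zero => exact fun x hx => ⟨x, hx, rfl⟩
  | succ n ih =>
    intro x hx
    obtain ⟨y, hy, rfl⟩ := ih hx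
    refine ⟨(C.mapPow n T.adjoint).op y,
      C.mapPow_mem_powSub n T.adjoint (fun x hx => adjoint_mem_tensorSub hx) y hy, ?_⟩
    have h1 := C.mapPow_eq_self n (T.mp.adjoint.comp T.adjoint) (fun x hx =>
      (mp_adjoint_adjoint hT x).trans
        (op_mp_of_mem_range hT (orthogonal_wanderingSpan_le_range hT hx))) y hy
    rw [mapPow_comp] at h1
    exact congrArg (iter T.mp.adjoint n).op h1

/-- Moving each factor `(T†)*` to the other side produces `T†T` on `E ⊗ W`, which disappears. -/
theorem inner_iter_iter (hT : IsBiregular T) (n : ℕ) (w : C.pow n X) :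
    ∀ e ∈ C.powSub n (wanderingSpan T),
      ⟪(iter T.mp.adjoint n).op w, (iter T n).op e⟫_ℂ = ⟪w, e⟫_ℂ := by
  induction n with
  | zero => exact fun e _ => rfl
  | succ n ih =>
    intro e he
    refine (ih ((C.mapPow n T.mp.adjoint).op w) ((C.mapPow n T).op e)
      (C.mapPow_mem_powSub n T (fun z hz => op_mem_wanderingSpan hz) e he)).trans ?_
    rw [mapPow_adjoint]
    refine (ContinuousLinearMap.adjoint_inner_left _ _ _).trans ?_
    have h1 := C.mapPow_eq_self n (T.mp.comp T) (fun z hz => mp_op_of_mem hT hz) e he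
    rw [mapPow_comp] at h1
    exact congrArg (fun v => ⟪w, v⟫_ℂ) h1

theorem genRange_cauchyDual (hT : IsBiregular T) :
    genRange (cauchyDual T) = (wanderingSpan T)ᗮ := by
  rw [cauchyDual_eq hT.1.2]
  apply le_antisymm
  · have h : wanderingSpan T ≤ (genRange T.mp.adjoint)ᗮ := by
      refine Submodule.topologicalClosure_minimal _ (iSup_le fun n => ?_)
        (Submodule.isClosed_orthogonal _)
      rintro _ ⟨e, he, rfl⟩
      rw [Submodule.mem_orthogonal]
      intro x hx
      -- Level `n + 1` rather than `n`: after cancelling `n` factors against `T_n`, one factor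
      -- `(T†)*` remains, whose adjoint `I ⊗ T†` kills `E^{⊗ n} ⊗ 𝓔`.
      obtain ⟨z, rfl⟩ := (Submodule.mem_iInf _).1 hx (n + 1)
      refine (inner_iter_iter hT n ((C.mapPow n T.mp.adjoint).op z) e
        (C.powSub_mono n le_genSpan he)).trans ?_
      rw [mapPow_adjoint]
      refine (ContinuousLinearMap.adjoint_inner_left _ _ _).trans ?_
      rw [C.mapPow_eq_zero n T.mp (fun x hx => mp_of_mem_wandering hT.1.2 hx) e he]
      exact inner_zero_right _
    exact (Submodule.le_orthogonal_orthogonal _).trans (Submodule.orthogonal_le h)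
  · refine le_iInf fun n => (mem_map_iter_powSub hT.1.2 n).trans ?_
    rintro _ ⟨y, _, rfl⟩
    exact ⟨y, rfl⟩

/-! ### Subspaces orthogonal to `[𝓔]_T` -/

/-- Common induction for 3 ⇒ 1 and 4 ⇒ 1. The vectors `z` are restricted to `E ⊗ (W ∩ K)` with `K`
the reducing core of `Mᗮ`: the factor `W` makes `T†T` trivial there, and reducing `K` makes `E ⊗ K`
orthogonal to `E ⊗ M` though `M` need not be reducing. -/
theorem wanderingSpan_le_orthogonal {M : Submodule ℂ X} (hM : M ≤ T.op.range)
    (h : ∀ m ∈ M, ∀ z ∈ C.tensorSub (wanderingSpan T ⊓ X.redCore Mᗮ), ⟪m, T.op z⟫_ℂ = 0) :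
    wanderingSpan T ≤ Mᗮ := by
  have h0 : wanderingSpan T ≤ X.redCore (wanderingSpan T ⊓ Mᗮ) := by
    refine genSpan_le_of_redCore wandering_isReducing
      (IsClosed.inter isClosed_genSpan (Submodule.isClosed_orthogonal M))
      (le_inf le_genSpan (Submodule.orthogonal_le hM)) fun z hz => ?_
    have hz1 := C.tensorSub_mono ((X.redCore_le _).trans inf_le_left) hz
    refine ⟨op_mem_wanderingSpan hz1, (Submodule.mem_orthogonal _ _).2 fun m hm => h m hm z ?_⟩
    exact C.tensorSub_mono (le_inf ((X.redCore_le _).trans inf_le_left)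
      (X.le_redCore (X.redCore_isReducing _) ((X.redCore_le _).trans inf_le_right))) hz
  exact h0.trans ((X.redCore_le _).trans inf_le_right)

theorem tensorSub_isOrtho_redCore (M N : Submodule ℂ X) :
    C.tensorSub M ⟂ C.tensorSub (N ⊓ X.redCore Mᗮ) :=
  Submodule.IsOrtho.mono_right (C.tensorSub_mono inf_le_right)
    (C.tensorSub_isOrtho (X.redCore_isReducing _)
      (Submodule.IsOrtho.mono_right (X.redCore_le _) (Submodule.isOrtho_orthogonal_right M)))

theorem wanderingSpan_ne_top {M : Submodule ℂ X} (hM : M ≠ ⊥) (h : wanderingSpan T ≤ Mᗮ) :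
    wanderingSpan T ≠ ⊤ := by
  intro ht
  rw [ht, top_le_iff, Submodule.orthogonal_eq_top_iff] at h
  exact hM h

theorem wanderingSpan_ne_top_of_le_map_cauchyDual (hT : IsBiregular T) {M : Submodule ℂ X}
    (hM0 : M ≠ ⊥) (hM : M ≤ (C.tensorSub M).map (cauchyDual T).op.toLinearMap) :
    wanderingSpan T ≠ ⊤ := by
  rw [cauchyDual_eq hT.1.2] at hM
  refine wanderingSpan_ne_top hM0 (wanderingSpan_le_orthogonal (fun m hm => ?_)
    fun m hm z hz => ?_)
  · refine mem_range_of_mem_orthogonal hT.1.2 ((Submodule.mem_orthogonal' _ _).2 fun y hy => ?_)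
    obtain ⟨w, _, rfl⟩ := hM hm
    refine (ContinuousLinearMap.adjoint_inner_left _ _ _).trans ?_
    rw [mp_of_mem_wandering hT.1.2 hy, inner_zero_right]
  · obtain ⟨w, hw, rfl⟩ := hM hm
    refine (ContinuousLinearMap.adjoint_inner_left _ _ _).trans ?_
    -- For `m = T'w` with `w ∈ E ⊗ M`, this reduces `⟪T'w, Tz⟫ = ⟪w, T†Tz⟫` to `⟪w, z⟫`.
    rw [mp_op_of_mem hT (C.tensorSub_mono inf_le_left hz)]
    exact (tensorSub_isOrtho_redCore M _).inner_eq hw hz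

theorem wanderingSpan_ne_top_of_adjoint {M : Submodule ℂ X} (hM0 : M ≠ ⊥)
    (hMr : M ≤ T.op.range) (hM : M.map T.adjoint.op.toLinearMap ≤ C.tensorSub M) :
    wanderingSpan T ≠ ⊤ := by
  refine wanderingSpan_ne_top hM0 (wanderingSpan_le_orthogonal hMr fun m hm z hz => ?_)
  refine (ContinuousLinearMap.adjoint_inner_left _ _ _).symm.trans ?_
  exact (tensorSub_isOrtho_redCore M _).inner_eq (hM ⟨m, hm, rfl⟩) hz

/-! ### Splittings of the range -/

theorem isRangeSplitting_wanderingSpan (hT : IsBiregular T) {M₁ M₂ : ClosedSubmodule ℂ X}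
    (h₁ : M₁.toSubmodule = wanderingSpan T ⊓ T.op.range)
    (h₂ : M₂.toSubmodule = (wanderingSpan T)ᗮ) : IsRangeSplitting T M₁ M₂ := by
  have hGc : CompleteSpace (wanderingSpan T) :=
    (isClosed_genSpan (T := T) (M := wandering T)).completeSpace_coe
  have hRc : CompleteSpace T.op.range := hT.1.2.completeSpace_coe
  have hle := orthogonal_wanderingSpan_le_range hT.1.2
  have hdec : ∀ x, ∃ a ∈ wanderingSpan T, ∃ b ∈ (wanderingSpan T)ᗮ, x = a + b := fun x =>
    ⟨_, Submodule.starProjection_apply_mem (wanderingSpan T) x, _,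
      Submodule.sub_starProjection_mem_orthogonal (K := wanderingSpan T) x, by abel⟩
  refine ⟨?_, ?_, ?_, ?_, ?_⟩
  · rw [h₁, Submodule.map_le_iff_le_comap]
    exact fun z hz => ⟨op_mem_wanderingSpan (C.tensorSub_mono inf_le_left hz), ⟨z, rfl⟩⟩
  · rw [h₁, Submodule.map_le_iff_le_comap]
    -- As `𝓔 ⊆ W`, splitting a vector of `W` along `R(T) ⊕ 𝓔` does not leave `W`.
    have h : wanderingSpan T ≤ wanderingSpan T ⊓ T.op.range ⊔ wandering T := by
      intro x hx
      have h1 := Submodule.sub_starProjection_mem_orthogonal (K := T.op.range) x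
      have h2 : x = T.op.range.starProjection x + (x - T.op.range.starProjection x) := by abel
      rw [h2]
      refine Submodule.add_mem_sup ⟨?_, Submodule.starProjection_apply_mem _ x⟩ h1
      have h3 := Submodule.sub_mem _ hx (le_genSpan (T := T) h1)
      simpa using h3
    exact fun x hx => C.tensorSub_mono h (mp_mem_tensorSub hT x hx.1)
  · apply le_antisymm
    · rintro _ ⟨y, _, rfl⟩
      exact Submodule.starProjection_apply_mem _ y
    · intro x hx
      have hx' : x ∈ (wanderingSpan T)ᗮ := h₂ ▸ hx
      -- Split `T†x = a + b` along `E ⊗ Wᗮ` and `E ⊗ W`. Then `x = TT†x = Ta + Tb` with `Tb ∈ W`, so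
      -- projecting onto `Wᗮ` shows that `a` is the required preimage.
      have hz : T.mp.op x ∈ C.tensorSub ((wanderingSpan T)ᗮ ⊔ wanderingSpan T) := by
        rw [sup_comm, Submodule.sup_orthogonal_of_hasOrthogonalProjection, tensorSub_top]
        trivial
      obtain ⟨a, ha, b, hb, hab⟩ := C.exists_add_of_mem_tensorSub_sup wanderingSpan_isReducing
        (Submodule.isOrtho_orthogonal_left _) hz
      refine ⟨T.op a, ⟨a, h₂ ▸ ha, rfl⟩, ?_⟩
      have h1 : T.op a = x - T.op b := by
        rw [eq_sub_iff_add_eq, ← map_add, ← hab, op_mp_of_mem_range hT.1.2 (hle hx')]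
      change M₂.toSubmodule.starProjection (T.op a) = x
      rw [h1, map_sub, Submodule.starProjection_eq_self_iff.2 hx,
        (Submodule.starProjection_apply_eq_zero_iff _).2 ?_, sub_zero]
      rw [h₂]
      exact Submodule.le_orthogonal_orthogonal _ (op_mem_wanderingSpan hb)
  · rw [h₁, h₂]
    exact (Submodule.isOrtho_orthogonal_right _).mono_left inf_le_left
  · rw [h₁, h₂]
    refine le_antisymm (fun x hx => ?_) (sup_le inf_le_right hle)
    obtain ⟨a, ha, b, hb, rfl⟩ := hdec x
    refine Submodule.add_mem_sup ⟨ha, ?_⟩ hb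
    simpa using Submodule.sub_mem _ hx (hle hb)

/-- `T†T` is an orthogonal projection, so the hypothesis says that the norm of `T†Ta` is zero. -/
theorem op_eq_zero_of_inner_eq_zero (hT : IsClosed (T.op.range : Set X)) {a : C.tensor X}
    (h : ⟪a, T.mp.op (T.op a)⟫_ℂ = 0) : T.op a = 0 := by
  have h1 : T.mp.op (T.op a) = 0 := by
    rw [← inner_self_eq_zero (𝕜 := ℂ), inner_mp_op hT, op_mp_op hT, h]
  rw [← op_mp_op hT, h1, map_zero]

/-- `M₁` and `M₂` need not be reducing, so they are replaced by `K`, the closed reducing hull of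
`M₁`, and `F = Kᗮ ∩ 𝓔ᗮ`, with `F ⊆ M₂ ⊆ K + F`. Then `P_{M₂}T` still maps `E ⊗ F` onto `M₂`, which
forces `F ≠ 0`, and `T†` maps `Fᗮ` into `E ⊗ Fᗮ`. These two facts make `Fᗮ` invariant under `T`. -/
theorem IsRangeSplitting.wanderingSpan_ne_top (hT : IsBiregular T) {M₁ M₂ : ClosedSubmodule ℂ X}
    (h : IsRangeSplitting T M₁ M₂) (h0 : M₂.toSubmodule ≠ ⊥) : wanderingSpan T ≠ ⊤ := by
  obtain ⟨hinv, hmp, hproj, hort, hrange⟩ := h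
  have hc₂ : CompleteSpace M₂.toSubmodule := M₂.isClosed.completeSpace_coe
  have hm₁ : M₁.toSubmodule ≤ T.op.range := hrange ▸ le_sup_left
  have hm₂ : M₂.toSubmodule ≤ T.op.range := hrange ▸ le_sup_right
  set K := (X.redHull M₁.toSubmodule).topologicalClosure with hK
  have hKr : X.IsReducing K := (X.redHull_isReducing _).topologicalClosure
  have hKc : IsClosed (K : Set X) := Submodule.isClosed_topologicalClosure _
  have hKcs : CompleteSpace K := hKc.completeSpace_coe
  have hM₁K : M₁.toSubmodule ≤ K := (X.le_redHull _).trans (Submodule.le_topologicalClosure _)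
  have hKrange : K ≤ T.op.range := Submodule.topologicalClosure_minimal _
    (X.redHull_le (HilbertRep.IsReducing.range T) hm₁) hT.1.2
  -- Enlarging `M₁` to `K` does not enlarge `E ⊗ M₁`, so the image stays in `M₁` itself and not
  -- merely in `K`.
  have hTK : ∀ z ∈ C.tensorSub K, T.op z ∈ M₁.toSubmodule := by
    intro z hz
    rw [hK, tensorSub_topologicalClosure] at hz
    exact hinv ⟨z, C.tensorSub_redHull_le _ hz, rfl⟩
  set F := Kᗮ ⊓ (wandering T)ᗮ with hF
  have hFr : X.IsReducing F := hKr.orthogonal.inf wandering_isReducing.orthogonal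
  have hFc : IsClosed (F : Set X) :=
    IsClosed.inter (Submodule.isClosed_orthogonal _) (Submodule.isClosed_orthogonal _)
  have hFcs : CompleteSpace F := hFc.completeSpace_coe
  have hKF : K ⟂ F := (Submodule.isOrtho_orthogonal_right K).mono_right inf_le_left
  have hM₂KF : M₂.toSubmodule ≤ K ⊔ F := by
    intro x hx
    have h1 := Submodule.sub_starProjection_mem_orthogonal (K := K) x
    have h2 := Submodule.starProjection_apply_mem K x
    have h3 : x = K.starProjection x + (x - K.starProjection x) := by abel
    rw [h3]
    refine Submodule.add_mem_sup h2 ⟨h1, ?_⟩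
    exact Submodule.le_orthogonal_orthogonal _ (Submodule.sub_mem _ (hm₂ hx) (hKrange h2))
  have hFM₂ : F ≤ M₂.toSubmodule := by
    intro x hx
    have h1 := mem_range_of_mem_orthogonal hT.1.2 hx.2
    rw [hrange] at h1
    obtain ⟨a, ha, b, hb, rfl⟩ := Submodule.mem_sup.1 h1
    have h2 : ⟪a, a⟫_ℂ = 0 := by
      have h3 : ⟪a, a + b⟫_ℂ = 0 := (Submodule.mem_orthogonal _ _).1 hx.1 a (hM₁K ha)
      rwa [inner_add_right, hort.inner_eq ha hb, add_zero] at h3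
    rw [inner_self_eq_zero.1 h2, zero_add]
    exact hb
  have hPM₁ : ∀ x ∈ M₁.toSubmodule, M₂.toSubmodule.starProjection x = 0 := fun x hx =>
    (Submodule.starProjection_apply_eq_zero_iff _).2 (hort hx)
  have hFF : IsClosed (Fᗮ : Set X) := Submodule.isClosed_orthogonal _
  have hFFr : X.IsReducing Fᗮ := hFr.orthogonal
  have hKF' : K ≤ Fᗮ := hKF
  have hWF : wandering T ≤ Fᗮ :=
    (Submodule.le_orthogonal_orthogonal _).trans (Submodule.orthogonal_le inf_le_right)
  have hFcl : Fᗮ = (K ⊔ wandering T).topologicalClosure := by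
    rw [hF, Submodule.inf_orthogonal, Submodule.orthogonal_orthogonal_eq_closure]
  have hmpF : ∀ x ∈ Fᗮ, T.mp.op x ∈ C.tensorSub Fᗮ := by
    have h1 : Fᗮ ≤ (C.tensorSub Fᗮ).comap T.mp.op.toLinearMap := by
      have hc := Submodule.isClosed_comap T.mp.op (C.isClosed_tensorSub Fᗮ)
      rw [hFcl]
      refine Submodule.topologicalClosure_minimal _ (sup_le ?_ fun x hx => ?_) (hFcl ▸ hc)
      · rw [← hFcl]
        -- The preimage of `E ⊗ Fᗮ` under `T†` is closed and reducing, so containing `M₁` is enough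
        -- for it to contain `K`.
        refine Submodule.topologicalClosure_minimal _ (X.redHull_le (fun b x hx => ?_) ?_) hc
        · change T.mp.op (X.rep b x) ∈ C.tensorSub Fᗮ
          rw [T.mp.op_rep]
          exact C.tensorSub_isReducing _ b _ hx
        · exact fun x hx => C.tensorSub_mono (sup_le (hM₁K.trans hKF') hWF) (hmp ⟨x, hx, rfl⟩)
      · change T.mp.op x ∈ C.tensorSub _
        rw [mp_of_mem_wandering hT.1.2 hx]
        exact zero_mem _
    exact h1
  have hinj : ∀ a ∈ C.tensorSub F, T.mp.op (T.op a) ∈ C.tensorSub Fᗮ → T.op a = 0 :=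
    fun a ha hb => op_eq_zero_of_inner_eq_zero hT.1.2
      ((C.tensorSub_isOrtho hFFr (Submodule.isOrtho_orthogonal_right F)).inner_eq ha hb)
  -- The component of a preimage in `E ⊗ K` is wasted: `T` sends it into `M₁`, which `P_{M₂}` kills.
  have hsurj : ∀ f ∈ M₂.toSubmodule, ∃ a ∈ C.tensorSub F,
      M₂.toSubmodule.starProjection (T.op a) = f := by
    intro f hf
    rw [← hproj] at hf
    obtain ⟨_, ⟨a, ha, rfl⟩, rfl⟩ := hf
    obtain ⟨k, hk, b, hb, rfl⟩ :=
      C.exists_add_of_mem_tensorSub_sup hFr hKF (C.tensorSub_mono hM₂KF ha)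
    refine ⟨b, hb, ?_⟩
    change _ = M₂.toSubmodule.starProjection (T.op (k + b))
    rw [map_add, map_add, hPM₁ _ (hTK k hk), zero_add]
  have hF0 : F ≠ ⊥ := by
    intro hF0
    refine h0 ((Submodule.eq_bot_iff _).2 fun f hf => ?_)
    obtain ⟨a, ha, rfl⟩ := hsurj f hf
    rw [hF0, tensorSub_bot, Submodule.mem_bot] at ha
    rw [ha, map_zero, map_zero]
  have hle : wanderingSpan T ≤ Fᗮ := by
    refine genSpan_le hFF hWF fun z hz => ?_
    have hz' : z ∈ C.tensorSub (K ⊔ wandering T) := by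
      rwa [← tensorSub_topologicalClosure, ← hFcl]
    obtain ⟨k, hk, w, hw, rfl⟩ := C.exists_add_of_mem_tensorSub_sup wandering_isReducing
      ((Submodule.isOrtho_orthogonal_right _).mono_left hKrange) hz'
    rw [map_add]
    refine Submodule.add_mem _ (hKF' (hM₁K (hTK k hk))) ?_
    have hw1 : T.mp.op (T.op w) = w := mp_op_of_mem hT (C.tensorSub_mono le_genSpan hw)
    -- For `w ∈ E ⊗ 𝓔` the `F`-component `f` of `Tw` must vanish. From `T†Tw = w` one gets `T†f ∈ E
    -- ⊗ Fᗮ`. Choosing `a ∈ E ⊗ F` with `P_{M₂}Ta = f`, the difference `Ta - f` lies in `M₁`, so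
    -- `T†Ta ∈ E ⊗ Fᗮ` is orthogonal to `a`. Hence `Ta = 0` and `f = 0`.
    set f := F.starProjection (T.op w) with hf
    have hfF : f ∈ F := Submodule.starProjection_apply_mem _ _
    have hm : T.op w - f ∈ Fᗮ := Submodule.sub_starProjection_mem_orthogonal _
    have hLf : T.mp.op f ∈ C.tensorSub Fᗮ := by
      have h1 := Submodule.sub_mem _ (C.tensorSub_mono hWF hw) (hmpF _ hm)
      rwa [map_sub, hw1, sub_sub_cancel] at h1
    obtain ⟨a, ha, haf⟩ := hsurj f (hFM₂ hfF)
    have h1 : T.op a - f ∈ M₁.toSubmodule := by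
      have h2 : T.op a ∈ M₁.toSubmodule ⊔ M₂.toSubmodule := hrange ▸ ⟨a, rfl⟩
      obtain ⟨x, hx, y, hy, hxy⟩ := Submodule.mem_sup.1 h2
      have h3 : f = y := by
        rw [← haf, ← hxy, map_add, hPM₁ x hx, zero_add]
        exact Submodule.starProjection_eq_self_iff.2 hy
      rw [← hxy, h3, add_sub_cancel_right]
      exact hx
    have h2 : T.op a = 0 := by
      refine hinj a ha ?_
      have h3 := Submodule.add_mem _ (hmpF _ (hKF' (hM₁K h1))) hLf
      rwa [← map_add, sub_add_cancel] at h3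
    have h3 : f = 0 := by rw [← haf, h2, map_zero]
    rwa [h3, sub_zero] at hm
  exact CStarCorrespondence.wanderingSpan_ne_top hF0 hle

end CStarCorrespondence

end

/-! ### The equivalences. -/

theorem mainTheorem2 {B : Type v} {E H : Type u} [NonUnitalCStarAlgebra B] [PartialOrder B]
    [StarOrderedRing B] [NormedAddCommGroup E] [NormedSpace ℂ E] [CompleteSpace E]
    [NormedAddCommGroup H] [InnerProductSpace ℂ H] [CompleteSpace H]
    (C : CStarCorrespondence B E) (R : CBCRep C H)
    (hR : CStarCorrespondence.IsBiregular R.tilde) :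
    List.TFAE
      [ CStarCorrespondence.genSpan R.tilde (CStarCorrespondence.wandering R.tilde) ≠ ⊤,
        CStarCorrespondence.genRange (CStarCorrespondence.cauchyDual R.tilde) ≠ ⊥,
        ∃ M : ClosedSubmodule ℂ R.toRep, M.toSubmodule ≠ ⊥ ∧
          M.toSubmodule ≤ (C.tensorSub M.toSubmodule).map
            (CStarCorrespondence.cauchyDual R.tilde).op.toLinearMap,
        ∃ M : ClosedSubmodule ℂ R.toRep, M.toSubmodule ≠ ⊥ ∧
          M.toSubmodule ≤ R.tilde.op.range ∧
          M.toSubmodule.map R.tilde.adjoint.op.toLinearMap ≤ C.tensorSub M.toSubmodule,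
        ∃ M : ClosedSubmodule ℂ R.toRep,
          CStarCorrespondence.wandering R.tilde ≤ M.toSubmodule ∧ M.toSubmodule ≠ ⊤ ∧
          (C.tensorSub M.toSubmodule).map R.tilde.op.toLinearMap ≤ M.toSubmodule,
        ∃ M : ClosedSubmodule ℂ R.toRep,
          CStarCorrespondence.wandering R.tilde ≤ M.toSubmodule ∧ M.toSubmodule ≠ ⊤ ∧
          C.tensorSub M.toSubmodule ≤ M.toSubmodule.map R.tilde.mp.op.toLinearMap,
        ∃ M₁ M₂ : ClosedSubmodule ℂ R.toRep, M₂.toSubmodule ≠ ⊥ ∧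
          CStarCorrespondence.IsRangeSplitting R.tilde M₁ M₂ ] ∧
    (C.tensorSub (CStarCorrespondence.wandering R.tilde) ≠ ⊥ →
      (CStarCorrespondence.genSpan R.tilde (CStarCorrespondence.wandering R.tilde) ≠ ⊤ ↔
        ∃ M₁ M₂ : ClosedSubmodule ℂ R.toRep, M₁.toSubmodule ≠ ⊥ ∧ M₂.toSubmodule ≠ ⊥ ∧
          CStarCorrespondence.IsRangeSplitting R.tilde M₁ M₂)) := by
  have hT := hR.1.2
  have hGc : IsClosed (CStarCorrespondence.wanderingSpan R.tilde : Set R.toRep) :=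
    CStarCorrespondence.isClosed_genSpan
  have hGcs : CompleteSpace (CStarCorrespondence.wanderingSpan R.tilde) := hGc.completeSpace_coe
  let G : ClosedSubmodule ℂ R.toRep := ⟨CStarCorrespondence.wanderingSpan R.tilde, hGc⟩
  let G' : ClosedSubmodule ℂ R.toRep :=
    ⟨(CStarCorrespondence.wanderingSpan R.tilde)ᗮ, Submodule.isClosed_orthogonal _⟩
  let M₁ : ClosedSubmodule ℂ R.toRep :=
    ⟨CStarCorrespondence.wanderingSpan R.tilde ⊓ R.tilde.op.range, hGc.inter hT⟩
  have hsplit : CStarCorrespondence.IsRangeSplitting R.tilde M₁ G' :=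
    CStarCorrespondence.isRangeSplitting_wanderingSpan hR rfl rfl
  have hne : CStarCorrespondence.wanderingSpan R.tilde ≠ ⊤ →
      (CStarCorrespondence.wanderingSpan R.tilde)ᗮ ≠ ⊥ :=
    fun h h' => h (Submodule.orthogonal_eq_bot_iff.1 h')
  have hle := CStarCorrespondence.orthogonal_wanderingSpan_le_range hT
  refine ⟨?_, fun hE => ⟨fun h => ⟨M₁, G', fun h0 => hE ?_, hne h, hsplit⟩, ?_⟩⟩
  · tfae_have 1 ↔ 2 := by
      rw [CStarCorrespondence.genRange_cauchyDual hR, ne_eq, ne_eq,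
        Submodule.orthogonal_eq_bot_iff]
    tfae_have 1 → 3 := by
      refine fun h => ⟨G', hne h, fun x hx => ⟨R.tilde.adjoint.op x,
        CStarCorrespondence.adjoint_mem_tensorSub hx, ?_⟩⟩
      rw [CStarCorrespondence.cauchyDual_eq hT]
      exact (CStarCorrespondence.mp_adjoint_adjoint hT x).trans
        (CStarCorrespondence.op_mp_of_mem_range hT (hle hx))
    tfae_have 3 → 1 := fun ⟨M, h0, h⟩ =>
      CStarCorrespondence.wanderingSpan_ne_top_of_le_map_cauchyDual hR h0 h
    tfae_have 1 → 4 := fun h => ⟨G', hne h, hle, Submodule.map_le_iff_le_comap.2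
      fun x hx => CStarCorrespondence.adjoint_mem_tensorSub hx⟩
    tfae_have 4 → 1 := fun ⟨M, h0, h1, h2⟩ =>
      CStarCorrespondence.wanderingSpan_ne_top_of_adjoint h0 h1 h2
    tfae_have 1 → 6 := fun h => ⟨G, CStarCorrespondence.le_genSpan, h, fun z hz =>
      ⟨R.tilde.op z, CStarCorrespondence.op_mem_wanderingSpan hz,
        CStarCorrespondence.mp_op_of_mem hR hz⟩⟩
    tfae_have 6 → 5 := by
      rintro ⟨M, h0, h1, h2⟩
      refine ⟨M, h0, h1, ?_⟩
      rintro _ ⟨z, hz, rfl⟩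
      obtain ⟨x, hx, rfl⟩ := h2 hz
      -- For `z = T†x` with `x ∈ M`, the vector `Tz = TT†x` differs from `x` by an element of `𝓔 ⊆
      -- M`.
      have h3 : x - R.tilde.op (R.tilde.mp.op x) ∈ CStarCorrespondence.wandering R.tilde :=
        CStarCorrespondence.sub_op_mp_mem_wandering hT x
      have h4 := M.toSubmodule.sub_mem hx (h0 h3)
      rwa [sub_sub_cancel] at h4
    tfae_have 5 → 1 := by
      rintro ⟨M, h0, h1, h2⟩ h
      refine h1 (top_le_iff.1 (h ▸ CStarCorrespondence.genSpan_le M.isClosed h0 fun z hz => ?_))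
      exact h2 ⟨z, hz, rfl⟩
    tfae_have 1 → 7 := fun h => ⟨M₁, G', hne h, hsplit⟩
    tfae_have 7 → 1 := fun ⟨M₁, M₂, h0, h⟩ => h.wanderingSpan_ne_top hR h0
    tfae_finish
  -- If `W ∩ R(T) = 0`, then `T` kills `E ⊗ 𝓔`; as `T†T` is the identity there, `E ⊗ 𝓔 = 0`.
  · refine (Submodule.eq_bot_iff _).2 fun z hz => ?_
    have hz' := C.tensorSub_mono (CStarCorrespondence.le_genSpan (T := R.tilde)) hz
    have h1 : R.tilde.op z ∈ M₁.toSubmodule :=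
      ⟨CStarCorrespondence.op_mem_wanderingSpan hz', ⟨z, rfl⟩⟩
    rw [h0, Submodule.mem_bot] at h1
    rw [← CStarCorrespondence.mp_op_of_mem hR hz', h1, map_zero]
  · rintro ⟨M₁, M₂, _, h0, h⟩
    exact h.wanderingSpan_ne_top hR h0
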